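/- Let $\Bbbk$ be an algebraically closed field; a variety is a reduced, separated scheme of finite type over $\Bbbk$ (possibly reducible), and $\mathrm{Aut}(X)$ is the group of automorphisms over $\Bbbk$ of a variety $X$. For a variety $A$, a map $\rho$ from (the closed points of) $A$ to $\mathrm{Aut}(X)$ is called a morphism if $A\times X\to X$, $(a,x)\mapsto\rho(a)(x)$, is a morphism of varieties. A subgroup $\mathcal G\subseteq\mathrm{Aut}(X)$ is connected if for every $g\in\mathcal G$ there are an irreducible variety $A$ and a morphism $\rho\colon A\to\mathrm{Aut}(X)$ with $\rho(A)\subseteq\mathcal G$ and $g,\mathrm{id}_X\in\rho(A)$. The dimension $\dim\mathcal G\in\{0,1,2,\dots\}\cup\{\infty\}$ of a subgroup $\mathcal G\subseteq\mathrm{Aut}(X)$ is the supremum of $\dim A$ over all injective morphisms $A\to\mathrm{Aut}(X)$ with image in $\mathcal G$, where $A$ is an irreducible variety. Let $X$ be a variety over $\Bbbk$, let $\mathcal G\subseteq\mathrm{Aut}(X)$ be a connected subgroup, and let $X'\subseteq X$ be a locally closed $\mathcal G$-invariant subvariety. Let $\mathcal G'\subseteq\mathrm{Aut}(X')$ denote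 the image of $\mathcal G$ under the restriction homomorphism $g\mapsto g|_{X'}$. Then $\dim\mathcal G'\le\dim\mathcal G$. -/

import Mathlib

open CategoryTheory AlgebraicGeometry MonoidalCategory CartesianMonoidalCategory

universe u

namespace VarietyAut

/-- A variety over the field `k`: a reduced and separated scheme of finite type over `k`,
possibly reducible. -/
class IsVariety {k : Type u} [Field k] (X : Over (Spec (CommRingCat.of k))) : Prop where
  isReduced : IsReduced X.left
  isSeparated : IsSeparated X.hom
  locallyOfFiniteType : LocallyOfFiniteType X.hom
  quasiCompact : QuasiCompact X.hom

/-- The `k`-rational points of a `k`-scheme. For varieties over an algebraically closed field these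
are the closed points, that is, the points of the variety in the classical sense. -/
abbrev Pt {k : Type u} [Field k] (X : Over (Spec (CommRingCat.of k))) : Type u :=
  𝟙_ (Over (Spec (CommRingCat.of k))) ⟶ X

/-- The map `ρ : A → Aut(X)` (defined on the points of `A`) is a morphism: the induced map
`A × X → X`, `(a, x) ↦ ρ(a)(x)`, is (the map on points of) a morphism of varieties over `k`. -/
def IsMorphismToAut {k : Type u} [Field k] {A X : Over (Spec (CommRingCat.of k))}
    (ρ : Pt A → Aut X) : Prop :=
  ∃ Φ : A ⊗ X ⟶ X, ∀ (a : Pt A) (x : Pt X), lift a x ≫ Φ = x ≫ (ρ a).hom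

/-- The subgroup `G` of `Aut(X)` is connected: every `g ∈ G` lies, together with the identity, in
the image of a morphism `A → Aut(X)` with `A` an irreducible variety and image contained in `G`. -/
def IsConnectedSubgroup {k : Type u} [Field k] {X : Over (Spec (CommRingCat.of k))}
    (G : Subgroup (Aut X)) : Prop :=
  ∀ g ∈ G, ∃ (A : Over (Spec (CommRingCat.of k))) (ρ : Pt A → Aut X),
    IsVariety A ∧ IrreducibleSpace A.left ∧ IsMorphismToAut ρ ∧ (∀ a, ρ a ∈ G) ∧
      g ∈ Set.range ρ ∧ 1 ∈ Set.range ρ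

/-- The dimension of the subgroup `G` of `Aut(X)`: the supremum of `dim A` over all injective
morphisms `A → Aut(X)` with image in `G`, where `A` is an irreducible variety. -/
noncomputable def dimSubgroup {k : Type u} [Field k] {X : Over (Spec (CommRingCat.of k))}
    (G : Subgroup (Aut X)) : WithBot ℕ∞ :=
  sSup {d | ∃ (A : Over (Spec (CommRingCat.of k))) (ρ : Pt A → Aut X),
    IsVariety A ∧ IrreducibleSpace A.left ∧ IsMorphismToAut ρ ∧ Function.Injective ρ ∧
      (∀ a, ρ a ∈ G) ∧ d = topologicalKrullDim A.left}

/-- The (locally closed) subscheme `i : X' ⟶ X` is invariant under `G`: every `g ∈ G` maps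
the underlying set of `X'` into itself. -/
def IsInvariant {k : Type u} [Field k] {X X' : Over (Spec (CommRingCat.of k))}
    (G : Subgroup (Aut X)) (i : X' ⟶ X) : Prop :=
  ∀ g ∈ G, ∀ x ∈ Set.range i.left, g.hom.left x ∈ Set.range i.left

theorem mono_of_isImmersion {k : Type u} [Field k] {X X' : Over (Spec (CommRingCat.of k))}
    (i : X' ⟶ X) [IsImmersion i.left] : Mono i :=
  Over.mono_of_mono_left i

/-- A morphism from a reduced scheme whose set-theoretic image lies in a locally closed subscheme
factors through that subscheme. -/
theorem exists_lift {S T X : Scheme.{u}} (i : S ⟶ X) [IsImmersion i] [IsReduced T] (f : T ⟶ X)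
    (h : Set.range f ⊆ Set.range i) : ∃ f' : T ⟶ S, f' ≫ i = f := by
  have hr : Set.range (Limits.pullback.fst f i) = Set.univ := by
    rw [Scheme.Pullback.range_fst]
    exact Set.eq_univ_of_forall fun x => h ⟨x, rfl⟩
  have hs : Surjective (Limits.pullback.fst f i) := ⟨Set.range_eq_univ.mp hr⟩
  have hc : IsClosedImmersion (Limits.pullback.fst f i) :=
    .of_isPreimmersion _ (by rw [hr]; exact isClosed_univ)
  have : IsIso (Limits.pullback.fst f i) := isIso_of_isClosedImmersion_of_surjective _
  exact ⟨inv (Limits.pullback.fst f i) ≫ Limits.pullback.snd f i, by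
    rw [Category.assoc, ← Limits.pullback.condition, IsIso.inv_hom_id_assoc]⟩

theorem exists_restrict {k : Type u} [Field k] {X X' : Over (Spec (CommRingCat.of k))}
    [IsVariety X'] (G : Subgroup (Aut X)) (i : X' ⟶ X) [IsImmersion i.left]
    (h : IsInvariant G i) (g : Aut X) (hg : g ∈ G) : ∃ g' : X' ⟶ X', g' ≫ i = i ≫ g.hom := by
  have := IsVariety.isReduced (X := X')
  obtain ⟨f, hf⟩ := exists_lift i.left (i.left ≫ g.hom.left) (by
    rintro _ ⟨x, rfl⟩
    simpa using h g hg (i.left x) ⟨x, rfl⟩)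
  refine ⟨Over.homMk f ?_, ?_⟩
  · rw [← Over.w i, ← Category.assoc, hf, Category.assoc, Over.w, Over.w]
  · ext1
    simpa using hf

/-- The restriction of `g ∈ G` to the `G`-invariant locally closed subvariety `X'` of `X`: the
unique morphism `X' ⟶ X'` with `restrict g ≫ i = i ≫ g`. -/
noncomputable def restrict {k : Type u} [Field k] {X X' : Over (Spec (CommRingCat.of k))}
    [IsVariety X'] (G : Subgroup (Aut X)) (i : X' ⟶ X) [IsImmersion i.left]
    (h : IsInvariant G i) (g : G) : X' ⟶ X' :=
  (exists_restrict G i h g.1 g.2).choose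

theorem restrict_comp {k : Type u} [Field k] {X X' : Over (Spec (CommRingCat.of k))}
    [IsVariety X'] (G : Subgroup (Aut X)) (i : X' ⟶ X) [IsImmersion i.left]
    (h : IsInvariant G i) (g : G) : restrict G i h g ≫ i = i ≫ g.1.hom :=
  (exists_restrict G i h g.1 g.2).choose_spec

theorem restrict_one {k : Type u} [Field k] {X X' : Over (Spec (CommRingCat.of k))}
    [IsVariety X'] (G : Subgroup (Aut X)) (i : X' ⟶ X) [IsImmersion i.left]
    (h : IsInvariant G i) : restrict G i h 1 = 𝟙 X' := by
  have := mono_of_isImmersion i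
  rw [← cancel_mono i, restrict_comp, Category.id_comp]
  exact Category.comp_id i

theorem restrict_mul {k : Type u} [Field k] {X X' : Over (Spec (CommRingCat.of k))}
    [IsVariety X'] (G : Subgroup (Aut X)) (i : X' ⟶ X) [IsImmersion i.left]
    (h : IsInvariant G i) (g₁ g₂ : G) :
    restrict G i h (g₁ * g₂) = restrict G i h g₂ ≫ restrict G i h g₁ := by
  have := mono_of_isImmersion i
  rw [← cancel_mono i, restrict_comp, Category.assoc, restrict_comp, ← Category.assoc,
    restrict_comp, Category.assoc]
  rfl

/-- The restriction homomorphism `G → Aut(X')`, `g ↦ g|_{X'}`, for a `G`-invariant locally closed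
subvariety `i : X' ⟶ X`. -/
noncomputable def restrictHom {k : Type u} [Field k] {X X' : Over (Spec (CommRingCat.of k))}
    [IsVariety X'] (G : Subgroup (Aut X)) (i : X' ⟶ X) [IsImmersion i.left]
    (h : IsInvariant G i) : G →* Aut X' where
  toFun g :=
    { hom := restrict G i h g
      inv := restrict G i h g⁻¹
      hom_inv_id := by rw [← restrict_mul, inv_mul_cancel, restrict_one]
      inv_hom_id := by rw [← restrict_mul, mul_inv_cancel, restrict_one] }
  map_one' := by
    ext1
    exact restrict_one G i h
  map_mul' g₁ g₂ := by
    ext1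
    exact restrict_mul G i h g₁ g₂

end VarietyAut

/-!
Only the case `d = dim G < ∞` matters. Families of automorphisms are compared through their values
at finite sets of points: for a finite set `s` of rational points of `X`, a family parametrized by
`A` has an evaluation morphism `A → X ^ s`. By noetherianity
(`exists_finset_forall_specMap_comp_eq`, `exists_finset_separating`), finitely many points suffice
to distinguish the members of a family.

The first ingredient is a bound for families that need not be injective: for an irreducible family
in `G` and a large finite set `s`, the closure of the image of the evaluation morphism has
dimension at most `d` (`exists_finset_topologicalKrullDim_closure_range_evalMap_le`). Choose `s`
so large that the values at `s` determine all values, also for points with values in arbitrary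
algebras. A dense open part `U` of this closure has a finite free cover that lifts to the parameter
space (`exists_finite_free_localization`). The family over this cover descends to `U` by
faithfully flat descent of morphisms (`exists_fac_of_flat`); the descent condition is verified on
the slices over the rational points of `X` (`hom_ext_of_forall_pt_slice`). The descended family is
injective, and so `dim U ≤ d`.

The second ingredient is that `G` does not move the values of a family of maximal dimension
(`val_mem_closure_range_evalAt`). Let `C` be an injective family in `G` of dimension `d` and let
`g ∈ G`. As `G` is connected, `g` and `1` lie in an irreducible family `B`. The values of the
product family `B × C` have a closure that is irreducible and of dimension at most `d`, and that
contains the `d`-dimensional closure of the values of `C`. So both closures agree, and the values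
of `g * c` lie in the closure `Y` of the values of `C`, whatever the finite set of points is.

Now let `A'` be an injective family in the restriction of `G` to `X'`, and let `s'` be a finite
set of points of `X'` that distinguishes its members. Fix `c` in `C`, and consider the values of
`C` at the points of `X` that `c` maps to `s'`. Every member of `A'` is the restriction of some
`g ∈ G`, and its values at `s'` are the values of `g * c` at these points; hence they lie in `Y`,
and `dim A' ≤ dim Y ≤ dim C = d`.
-/

/-! ### Finitely generated algebras -/

theorem ringKrullDim_eq_of_isIntegral {R S : Type*} [CommRing R] [CommRing S] [Algebra R S]
    [Algebra.IsIntegral R S] (h : Function.Injective (algebraMap R S)) :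
    ringKrullDim S = ringKrullDim R := by
  apply le_antisymm
  · refine Order.krullDim_le_of_strictMono (PrimeSpectrum.comap (algebraMap R S)) ?_
    intro I J hIJ
    obtain ⟨hle, x, hxJ, hxI⟩ := SetLike.lt_iff_le_and_exists.mp
      (show I.asIdeal < J.asIdeal from hIJ)
    exact Ideal.comap_lt_comap_of_integral_mem_sdiff hle ⟨hxJ, hxI⟩
      (Algebra.IsIntegral.isIntegral x)
  -- lying over and going up lift a chain of primes of `R` to a chain of the same length in `S`
  · refine iSup_le fun l => ?_
    obtain ⟨P, -, hP, hPl⟩ := Ideal.exists_ideal_over_prime_of_isIntegral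
      (RelSeries.head l).asIdeal (⊥ : Ideal S)
      (by rw [← RingHom.ker_eq_comap_bot, (RingHom.injective_iff_ker_eq_bot _).mp h]; exact bot_le)
    have : P.LiesOver (RelSeries.head l).asIdeal := ⟨hPl.symm⟩
    obtain ⟨L, hL, -⟩ := Ideal.exists_ltSeries_of_hasGoingUp l P
    rw [← hL]
    exact Order.LTSeries.length_le_krullDim L

theorem exists_ringKrullDim_eq_trdeg (k R : Type*) [Field k] [CommRing R] [IsDomain R]
    [Algebra k R] [Algebra.FiniteType k R] :
    ∃ n : ℕ, ringKrullDim R = n ∧ Algebra.trdeg k R = n := by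
  obtain ⟨n, g, hg, hint⟩ := exists_integral_inj_algHom_of_fg k R
  refine ⟨n, ?_, ?_⟩
  · algebraize [g.toRingHom]
    rw [ringKrullDim_eq_of_isIntegral (R := MvPolynomial (Fin n) k) hg]
    simp
  · let := g.toRingHom.toAlgebra
    have : Algebra.IsIntegral (MvPolynomial (Fin n) k) R := ⟨hint⟩
    have : FaithfulSMul (MvPolynomial (Fin n) k) R :=
      (faithfulSMul_iff_algebraMap_injective _ _).mpr hg
    have h := lift_trdeg_add_eq k (MvPolynomial (Fin n) k) R
    rw [MvPolynomial.trdeg_of_isDomain, trdeg_eq_zero] at h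
    simpa using h.symm

theorem ringKrullDim_le_of_algHom_injective {k R S : Type*} [Field k] [CommRing R] [CommRing S]
    [IsDomain R] [IsDomain S] [Algebra k R] [Algebra k S] [Algebra.FiniteType k R]
    [Algebra.FiniteType k S] (f : R →ₐ[k] S) (hf : Function.Injective f) :
    ringKrullDim R ≤ ringKrullDim S := by
  obtain ⟨m, hm, hm'⟩ := exists_ringKrullDim_eq_trdeg k R
  obtain ⟨n, hn, hn'⟩ := exists_ringKrullDim_eq_trdeg k S
  have := lift_trdeg_le_of_injective f hf
  rw [hm', hn'] at this
  rw [hm, hn]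
  simpa using this

theorem ringKrullDim_eq_of_isAlgebraic (k : Type*) {R S : Type*} [Field k] [CommRing R] [CommRing S]
    [IsDomain R] [IsDomain S] [Algebra k R] [Algebra k S] [Algebra R S] [IsScalarTower k R S]
    [Algebra.FiniteType k R] [Algebra.FiniteType k S] [FaithfulSMul R S]
    [Algebra.IsAlgebraic R S] :
    ringKrullDim S = ringKrullDim R := by
  obtain ⟨m, hm, hm'⟩ := exists_ringKrullDim_eq_trdeg k R
  obtain ⟨n, hn, hn'⟩ := exists_ringKrullDim_eq_trdeg k S
  have := lift_trdeg_add_eq k R S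
  rw [hm', hn', trdeg_eq_zero] at this
  rw [hm, hn]
  simpa using this.symm

/-- A dominant morphism `Spec R → Spec S` of finite type has a multivalued section over the generic
point: a closed point of the generic fibre, whose residue field is algebraic over `S`. -/
theorem exists_field_algHom {S R : Type u} [CommRing S] [IsDomain S]
    [CommRing R] [Algebra S R] [Algebra.FiniteType S R]
    (h : Function.Injective (algebraMap S R)) :
    ∃ (K : Type u) (_ : Field K) (_ : Algebra S K), Algebra.IsAlgebraic S K ∧
      Function.Injective (algebraMap S K) ∧ Nonempty (R →ₐ[S] K) := by
  let K := FractionRing S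
  let RK := TensorProduct S K R
  have : Nontrivial RK := by
    have := Module.Flat.lTensor_preserves_injective_linearMap (M := K)
        (Algebra.linearMap S R) h
    exact (this.comp (TensorProduct.rid S K).symm.injective).nontrivial
  obtain ⟨m, hm⟩ := Ideal.exists_maximal RK
  let K' := RK ⧸ m
  let : Field K' := Ideal.Quotient.field m
  have : Module.Finite K K' := finite_of_finite_type_of_isJacobsonRing K K'
  have : Algebra.IsAlgebraic K K' := Algebra.IsAlgebraic.of_finite K K'
  refine ⟨K', inferInstance, inferInstance,
    (IsFractionRing.comap_isAlgebraic_iff (K := K)).mpr this, ?_,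
    ⟨((Ideal.Quotient.mkₐ K m).restrictScalars S).comp Algebra.TensorProduct.includeRight⟩⟩
  rw [IsScalarTower.algebraMap_eq S K K']
  exact (algebraMap K K').injective.comp (IsFractionRing.injective S K)

theorem exists_free_localizationAway {S M : Type u} [CommRing S] [IsDomain S]
    [IsNoetherianRing S] [AddCommGroup M] [Module S M] [Module.Finite S M] :
    ∃ r : S, r ≠ 0 ∧
      Module.Free (Localization.Away r) (TensorProduct S (Localization.Away r) M) := by
  have := Module.finitePresentation_of_finite S M
  obtain ⟨r, hr, hfree, -⟩ := Module.FinitePresentation.exists_free_localizedModule_powers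
    (nonZeroDivisors S) (LocalizedModule.mkLinearMap (nonZeroDivisors S) M) (FractionRing S)
  refine ⟨r, nonZeroDivisors.ne_zero hr, ?_⟩
  exact Module.Free.of_equiv (LocalizedModule.equivTensorProduct (Submonoid.powers r) M)

/-- A dominant morphism `Spec R → Spec S` of finite type has a quasi-section: over a nonempty basic
open subset `Spec S'` of `Spec S` there is a finite free cover `Spec R'` that lifts to `Spec R`. -/
theorem exists_finite_free_localization {S R : Type u} [CommRing S] [IsDomain S]
    [IsNoetherianRing S] [CommRing R] [Algebra S R] [Algebra.FiniteType S R]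
    (h : Function.Injective (algebraMap S R)) :
    ∃ f : S, f ≠ 0 ∧ ∃ (S' R' : Type u) (_ : CommRing S') (_ : CommRing R') (_ : Algebra S S')
      (_ : Algebra S' R') (_ : Algebra S R') (_ : IsScalarTower S S' R'),
      IsLocalization.Away f S' ∧ Module.Finite S' R' ∧ Module.Free S' R' ∧
      Function.Injective (algebraMap S' R') ∧ Nonempty (R →ₐ[S] R') := by
  classical
  obtain ⟨K, _, _, _, hSK, ⟨φ⟩⟩ := exists_field_algHom h
  obtain ⟨t, ht⟩ := Algebra.FiniteType.out (R := S) (A := R)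
  -- after inverting `f`, the images in `K` of the generators of `R` become integral
  obtain ⟨f, hf, hft⟩ := Algebra.IsAlgebraic.exists_integral_multiples S (t.image φ)
  let S₁ := Localization.Away f
  have hfS : Submonoid.powers f ≤ nonZeroDivisors S :=
    powers_le_nonZeroDivisors_of_noZeroDivisors hf
  have : IsDomain S₁ := IsLocalization.isDomain_localization hfS
  let : Algebra S₁ K := (IsLocalization.liftAlgHom (M := Submonoid.powers f)
    (f := Algebra.ofId S K) (by
      rintro ⟨y, hy⟩
      have := nonZeroDivisors.ne_zero (hfS hy)
      simpa [Algebra.ofId_apply, map_eq_zero_iff _ hSK] using this)).toRingHom.toAlgebra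
  have hS₁K : Function.Injective (algebraMap S₁ K) :=
    IsLocalization.lift_injective_iff _ |>.mpr fun x y => by
      simp [hSK.eq_iff, (IsLocalization.injective S₁ hfS).eq_iff]
  let M : Subalgebra S₁ K := Algebra.adjoin S₁ (t.image φ)
  have : Module.Finite S₁ M := by
    refine ⟨(Submodule.fg_top _).mpr (fg_adjoin_of_finite (Finset.finite_toSet _) ?_)⟩
    intro x hx
    have h1 := (hft x hx).tower_top (A := S₁)
    rw [Algebra.smul_def, IsScalarTower.algebraMap_apply S S₁ K, ← Algebra.smul_def] at h1
    obtain ⟨u, hu⟩ := IsLocalization.Away.algebraMap_isUnit (S := S₁) f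
    rw [← hu] at h1
    have := h1.smul (u⁻¹ : S₁ˣ).1
    simpa [← smul_smul, smul_smul] using this
  have hφ : ∀ x, φ x ∈ M := by
    intro x
    have hx : x ∈ Algebra.adjoin S (t : Set R) := by rw [ht]; trivial
    have : (Algebra.adjoin S (t : Set R)) ≤ (M.restrictScalars S).comap φ :=
      Algebra.adjoin_le fun y hy => Algebra.subset_adjoin (by
        simpa using ⟨y, hy, rfl⟩)
    exact this hx
  let φ' : R →ₐ[S] M := φ.codRestrict (M.restrictScalars S) hφ
  -- generic freeness of the finite algebra `M`, with a denominator `a` taken from `S` itself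
  obtain ⟨r, hr, hfree⟩ := exists_free_localizationAway (S := S₁) (M := M)
  obtain ⟨n, a, ha⟩ := IsLocalization.Away.surj (S := S₁) f r
  let S₂ := Localization.Away r
  have ha0 : a ≠ 0 := by
    rintro rfl
    rw [map_zero] at ha
    exact hr ((mul_eq_zero.mp ha).resolve_right
      ((IsLocalization.Away.algebraMap_isUnit f).pow n).ne_zero)
  have : IsLocalization.Away (algebraMap S S₁ a) S₂ := by
    refine IsLocalization.Away.of_associated (r := r) ?_
    rw [← ha]
    exact associated_mul_unit_right _ _ ((IsLocalization.Away.algebraMap_isUnit f).pow n)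
  refine ⟨f * a, mul_ne_zero hf ha0, S₂, TensorProduct S₁ S₂ M, inferInstance, inferInstance,
    inferInstance, inferInstance, inferInstance, inferInstance,
    IsLocalization.Away.mul' S₁ S₂ f a, inferInstance, hfree, ?_,
    ⟨(Algebra.TensorProduct.includeRight.restrictScalars S).comp φ'⟩⟩
  have hM : Function.Injective (algebraMap S₁ M) := fun x y hxy =>
    hS₁K (congrArg Subtype.val hxy)
  have := Module.Flat.lTensor_preserves_injective_linearMap (M := S₂)
        (Algebra.linearMap S₁ M) hM
  convert! this.comp (TensorProduct.rid S₁ S₂).symm.injective using 1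
  ext x
  simp
  rfl

/-- Points with values in an algebraically closed field lift along integral extensions. -/
theorem exists_ringHom_comp_algebraMap_eq_of_isIntegral {R S k : Type*} [CommRing R] [CommRing S]
    [Field k] [IsAlgClosed k] [Algebra R S] [Algebra.IsIntegral R S]
    (h : Function.Injective (algebraMap R S)) (χ : R →+* k) :
    ∃ θ : S →+* k, θ.comp (algebraMap R S) = χ := by
  let P := RingHom.ker χ
  have : P.IsPrime := RingHom.ker_isPrime χ
  obtain ⟨Q, -, hQ, hQP⟩ := Ideal.exists_ideal_over_prime_of_isIntegral P (⊥ : Ideal S)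
      (by rw [← RingHom.ker_eq_comap_bot, (RingHom.injective_iff_ker_eq_bot _).mp h]; exact bot_le)
  have : Q.LiesOver P := ⟨hQP.symm⟩
  let : Algebra (R ⧸ P) k := (RingHom.kerLift χ).toAlgebra
  have hk : Function.Injective (algebraMap (R ⧸ P) k) := RingHom.kerLift_injective χ
  have : FaithfulSMul (R ⧸ P) k := (faithfulSMul_iff_algebraMap_injective _ _).mpr hk
  have : FaithfulSMul (R ⧸ P) (S ⧸ Q) := (faithfulSMul_iff_algebraMap_injective _ _).mpr <| by
    refine (injective_iff_map_eq_zero _).mpr fun x hx => ?_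
    obtain ⟨x, rfl⟩ := Ideal.Quotient.mk_surjective x
    rw [Ideal.Quotient.algebraMap_mk_of_liesOver, Ideal.Quotient.eq_zero_iff_mem] at hx
    rwa [Ideal.Quotient.eq_zero_iff_mem, ← hQP]
  have : Module.IsTorsionFree (R ⧸ P) (S ⧸ Q) :=
    Module.isTorsionFree_iff_faithfulSMul.mpr inferInstance
  let θ : S ⧸ Q →ₐ[R ⧸ P] k := IsAlgClosed.lift
  refine ⟨θ.toRingHom.comp (Ideal.Quotient.mk Q), ?_⟩
  ext x
  exact θ.commutes (Ideal.Quotient.mk P x)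

theorem exists_algHom_of_nontrivial (k R : Type*) [Field k] [IsAlgClosed k] [CommRing R]
    [Nontrivial R] [Algebra k R] [Algebra.FiniteType k R] : Nonempty (R →ₐ[k] k) := by
  obtain ⟨m, hm⟩ := Ideal.exists_maximal R
  let : Field (R ⧸ m) := Ideal.Quotient.field m
  have : Module.Finite k (R ⧸ m) := finite_of_finite_type_of_isJacobsonRing k (R ⧸ m)
  exact ⟨(IsAlgClosed.lift : R ⧸ m →ₐ[k] k).comp (Ideal.Quotient.mkₐ k m)⟩

theorem exists_algHom_apply_ne_zero {k R : Type*} [Field k] [IsAlgClosed k] [CommRing R]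
    [IsReduced R] [Algebra k R] [Algebra.FiniteType k R] {f : R} (hf : f ≠ 0) :
    ∃ φ : R →ₐ[k] k, φ f ≠ 0 := by
  have : Nontrivial (Localization.Away f) := by
    rw [← not_subsingleton_iff_nontrivial, IsLocalization.subsingleton_iff (M := .powers f)]
    rintro ⟨n, hn⟩
    exact hf (eq_zero_of_pow_eq_zero hn)
  obtain ⟨φ⟩ := exists_algHom_of_nontrivial k (Localization.Away f)
  refine ⟨φ.comp (IsScalarTower.toAlgHom k R _), ?_⟩
  exact ((IsLocalization.Away.algebraMap_isUnit f).map φ).ne_zero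

/-- A morphism of affine varieties that is dominant and injective on rational points is generically
finite. Otherwise some `t : R` is transcendental over `S`, and a quasi-section of
`Spec R → Spec S[t]` produces two points of `Spec R` over the same point of `Spec S` at which `t`
takes different values. -/
theorem isAlgebraic_of_injective_algHom_comp {k S R : Type u} [Field k] [IsAlgClosed k]
    [CommRing S] [CommRing R] [IsDomain S] [IsDomain R] [Algebra k S] [Algebra k R] [Algebra S R]
    [IsScalarTower k S R] [Algebra.FiniteType k S] [Algebra.FiniteType k R] [FaithfulSMul S R]
    (h : ∀ φ ψ : R →ₐ[k] k, (∀ x, φ (algebraMap S R x) = ψ (algebraMap S R x)) → φ = ψ) :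
    Algebra.IsAlgebraic S R := by
  by_contra halg
  obtain ⟨t, ht⟩ : ∃ t : R, Transcendental S t := by
    by_contra! hn
    exact halg ⟨fun x => not_not.mp (hn x)⟩
  let P := Polynomial S
  have : IsNoetherianRing S := Algebra.FiniteType.isNoetherianRing k S
  let : Algebra P R := (Polynomial.aeval t).toRingHom.toAlgebra
  have hPR : ∀ p : P, algebraMap P R p = Polynomial.aeval t p := fun _ => rfl
  have : IsScalarTower k P R := .of_algebraMap_eq fun x => by
    rw [IsScalarTower.algebraMap_apply k S R, IsScalarTower.algebraMap_apply k S P,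
      ← IsScalarTower.algebraMap_apply S P R]
  have : Algebra.FiniteType P R := .of_restrictScalars_finiteType k P R
  obtain ⟨f, hf, S', R', _, _, _, _, _, _, _, _, -, hinj, ⟨ψ⟩⟩ :=
    exists_finite_free_localization (S := P) (R := R) (transcendental_iff_injective.mp ht)
  obtain ⟨n, hn⟩ : ∃ n, f.coeff n ≠ 0 := by
    by_contra! hn
    exact hf (Polynomial.ext hn)
  obtain ⟨χ, hχ⟩ := exists_algHom_apply_ne_zero (k := k) hn
  have hχf : f.map χ.toRingHom ≠ 0 := fun h0 => hχ (by
    simpa using congrArg (Polynomial.coeff · n) h0)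
  -- every value of `t` outside the zeros of `f` extends `χ` to a point of `R`
  have key : ∀ a : k, (f.map χ.toRingHom).eval a ≠ 0 →
      ∃ θ : R →ₐ[k] k, (∀ x, θ (algebraMap S R x) = χ x) ∧ θ t = a := by
    intro a ha
    let e : P →+* k := Polynomial.eval₂RingHom χ.toRingHom a
    have he' : ∀ p, e p = Polynomial.eval₂ χ.toRingHom a p := fun _ => rfl
    have he : IsUnit (e f) := by
      rw [isUnit_iff_ne_zero]
      rwa [he', ← Polynomial.eval_map]
    obtain ⟨θ, hθ⟩ := exists_ringHom_comp_algebraMap_eq_of_isIntegral hinj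
      (IsLocalization.Away.lift f he : S' →+* k)
    have hP : ∀ p : P, θ (ψ (algebraMap P R p)) = e p := by
      intro p
      rw [ψ.commutes, IsScalarTower.algebraMap_apply P S' R']
      have := congrArg (· (algebraMap P S' p)) hθ
      simpa using this
    refine ⟨⟨θ.comp ψ.toRingHom, fun c => ?_⟩, fun x => ?_, ?_⟩
    · have := hP (algebraMap k P c)
      rw [← IsScalarTower.algebraMap_apply k P R] at this
      simpa [e, P, IsScalarTower.algebraMap_apply k S P] using this
    · have := hP (algebraMap S P x)
      rw [← IsScalarTower.algebraMap_apply S P R] at this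
      simpa [e, P] using this
    · have := hP Polynomial.X
      simpa [hPR, he'] using this
  have hinf : {a | (f.map χ.toRingHom).eval a ≠ 0}.Infinite := by
    have := (Polynomial.finite_setOfPred_isRoot hχf).infinite_compl
    exact this
  obtain ⟨a, ha, b, hb, hab⟩ := hinf.nontrivial
  obtain ⟨θ, hθ, rfl⟩ := key a ha
  obtain ⟨θ', hθ', rfl⟩ := key b hb
  exact hab (congrArg (· t) (h θ θ' fun x => by rw [hθ, hθ']))

/-! ### Dimension of topological spaces -/

open TopologicalSpace in
/-- The dimension of a space is bounded by the dimensions of the members of an open cover: a chain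
of irreducible closed subsets is seen in any open set that meets its smallest member. -/
theorem topologicalKrullDim_le_of_isOpenEmbedding {Z : Type u} [TopologicalSpace Z]
    {d : WithBot ℕ∞}
    (h : ∀ z : Z, ∃ (W : Type u) (_ : TopologicalSpace W) (f : W → Z),
      Topology.IsOpenEmbedding f ∧ z ∈ Set.range f ∧ topologicalKrullDim W ≤ d) :
    topologicalKrullDim Z ≤ d := by
  rcases isEmpty_or_nonempty Z with hZ | hZ
  · have : IsEmpty (IrreducibleCloseds Z) := ⟨fun T => hZ.elim T.2.nonempty.some⟩
    rw [topologicalKrullDim, Order.krullDim_eq_bot_iff.mpr this]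
    exact bot_le
  refine iSup_le fun l => ?_
  obtain ⟨z, hz⟩ := l.head.2.nonempty
  obtain ⟨W, _, f, hf, ⟨w, rfl⟩, hW⟩ := h z
  let T := (IrreducibleCloseds.orderIsoOfIsOpenEmbedding f hf).symm ⟨l.head, ⟨w, hz⟩⟩
  have hT : IrreducibleCloseds.map f hf.continuous T = l.head :=
    congrArg Subtype.val ((IrreducibleCloseds.orderIsoOfIsOpenEmbedding f hf).apply_symm_apply _)
  have h1 : (l.length : ℕ∞) ≤ Order.coheight l.head := Order.length_le_coheight_head
  rw [← hT, hf.coheight_map] at h1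
  calc ((l.length : ℕ) : WithBot ℕ∞) ≤ (Order.coheight T : WithBot ℕ∞) := by exact_mod_cast h1
    _ ≤ _ := Order.coheight_le_krullDim T
    _ ≤ d := hW

open TopologicalSpace in
theorem IsIrreducible.eq_of_topologicalKrullDim_le {Z : Type*} [TopologicalSpace Z] {Y₀ Y : Set Z}
    (hY : IsIrreducible Y) (hY₀ : IsClosed Y₀) (hle : Y₀ ⊆ Y) (n : ℕ)
    (h : topologicalKrullDim Y ≤ n) (h₀ : n ≤ topologicalKrullDim Y₀) : Y₀ = Y := by
  by_contra hne
  obtain ⟨l, hl⟩ := Order.le_krullDim_iff.mp h₀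
  have hincl : Topology.IsInducing (Set.inclusion hle) :=
    (Topology.IsEmbedding.inclusion hle).isInducing
  let l' := l.map _ (IrreducibleCloseds.map_strictMono_of_isInducing hincl)
  have : IrreducibleSpace Y := Subtype.irreducibleSpace hY
  let T : IrreducibleCloseds Y := ⟨Set.univ, IrreducibleSpace.isIrreducible_univ _, isClosed_univ⟩
  -- a chain of length `n` in `Y₀` would extend by `Y` itself to a chain of length `n + 1`
  have hlt : l'.last < T := by
    refine lt_of_le_of_ne (fun _ _ => trivial) fun heq => hne ?_
    refine hle.antisymm fun y hy => ?_
    have h1 : (⟨y, hy⟩ : Y) ∈ (l'.last : Set Y) := by rw [heq]; trivial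
    have h2 : (l'.last : Set Y) ⊆ Subtype.val ⁻¹' Y₀ := by
      have : (l'.last : Set Y) = closure (Set.inclusion hle '' (l.last : Set Y₀)) := rfl
      rw [this]
      refine closure_minimal ?_ (hY₀.preimage continuous_subtype_val)
      rintro _ ⟨x, -, rfl⟩
      exact x.2
    exact h2 h1
  have := Order.LTSeries.length_le_krullDim (l'.snoc T hlt)
  have h3 := this.trans h
  simp only [RelSeries.snoc_length] at h3
  have h4 : l'.length = n := hl
  rw [h4] at h3
  norm_cast at h3
  omega

namespace VarietyAut

variable {k : Type u} [Field k]

/-! ### Rational points -/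

/-- The underlying point of the scheme `X` of a rational point of `X`. -/
noncomputable def Pt.val {X : Over (Spec (CommRingCat.of k))} (p : Pt X) : X.left :=
  p.left (IsLocalRing.closedPoint k : Spec (CommRingCat.of k))

@[simp]
theorem Pt.val_comp {X Y : Over (Spec (CommRingCat.of k))} (p : Pt X) (f : X ⟶ Y) :
    Pt.val (p ≫ f) = f.left (Pt.val p) := rfl

theorem Pt.ext_val [IsAlgClosed k] {X : Over (Spec (CommRingCat.of k))}
    [LocallyOfFiniteType X.hom] {p q : Pt X} (h : Pt.val p = Pt.val q) : p = q := by
  ext1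
  exact ext_of_apply_closedPoint_eq X.hom (Over.w p) (Over.w q) h

theorem jacobsonSpace (X : Over (Spec (CommRingCat.of k))) [LocallyOfFiniteType X.hom] :
    JacobsonSpace X.left :=
  LocallyOfFiniteType.jacobsonSpace (Y := Spec _) X.hom

theorem exists_val_eq [IsAlgClosed k] (X : Over (Spec (CommRingCat.of k)))
    [LocallyOfFiniteType X.hom] {x : X.left} (hx : IsClosed {x}) : ∃ p : Pt X, Pt.val p = x :=
  ⟨Over.homMk (pointOfClosedPoint X.hom x hx) (pointOfClosedPoint_comp _ _ _),
    pointOfClosedPoint_apply _ _ _ _⟩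

theorem exists_val_mem [IsAlgClosed k] (X : Over (Spec (CommRingCat.of k)))
    [LocallyOfFiniteType X.hom] {Z : Set X.left} (hZ : IsLocallyClosed Z) (hne : Z.Nonempty) :
    ∃ p : Pt X, Pt.val p ∈ Z := by
  have := jacobsonSpace X
  obtain ⟨z, hz, hzc⟩ := nonempty_inter_closedPoints hne hZ
  obtain ⟨p, rfl⟩ := exists_val_eq X hzc
  exact ⟨p, hz⟩

theorem Pt.isClosed_val [IsAlgClosed k] {X : Over (Spec (CommRingCat.of k))}
    [LocallyOfFiniteType X.hom] (p : Pt X) : IsClosed {Pt.val p} :=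
  (pointEquivClosedPoint X.hom ⟨p.left, Over.w p⟩).2

theorem range_subset_of_forall_val_mem [IsAlgClosed k] {A Y : Over (Spec (CommRingCat.of k))}
    [LocallyOfFiniteType A.hom] (f : A ⟶ Y) {Z : Set Y.left} (hZ : IsClosed Z)
    (h : ∀ p : Pt A, Pt.val (p ≫ f) ∈ Z) : Set.range f.left ⊆ Z := by
  rintro _ ⟨a, rfl⟩
  by_contra ha
  obtain ⟨p, hp⟩ := exists_val_mem A (hZ.isOpen_compl.preimage f.left.continuous).isLocallyClosed
    ⟨a, ha⟩
  exact hp (h p)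

theorem hom_ext_of_pt [IsAlgClosed k] {X Y : Over (Spec (CommRingCat.of k))}
    [LocallyOfFiniteType X.hom] [IsReduced X.left] [IsSeparated Y.hom] [LocallyOfFiniteType Y.hom]
    {f g : X ⟶ Y} (h : ∀ p : Pt X, p ≫ f = p ≫ g) : f = g := by
  ext1
  have : LocallyOfFiniteType (f.left ≫ Y.hom) := by rw [Over.w]; infer_instance
  refine ext_of_apply_eq Y.hom Set.univ isClosed_univ.isLocallyClosed dense_univ ?_ (by simp)
  intro x _ hx
  obtain ⟨p, rfl⟩ := exists_val_eq X hx
  exact congrArg Pt.val (h p)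

/-- The product of irreducible schemes of finite type over an algebraically closed field is
irreducible: two nonempty open subsets both meet the slice over some rational point of the first
factor, and this slice is a copy of the irreducible second factor. -/
theorem irreducibleSpace_tensorObj [IsAlgClosed k] {A B : Over (Spec (CommRingCat.of k))}
    [LocallyOfFiniteType A.hom] [LocallyOfFiniteType B.hom] [IrreducibleSpace A.left]
    [IrreducibleSpace B.left] : IrreducibleSpace (A ⊗ B).left := by
  have : UniversallyOpen (fst A B).left := by dsimp; infer_instance
  have : LocallyOfFiniteType (A ⊗ B).hom := by dsimp; infer_instance
  obtain ⟨a₀, -⟩ := exists_val_mem A isOpen_univ.isLocallyClosed Set.univ_nonempty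
  obtain ⟨b₀, -⟩ := exists_val_mem B isOpen_univ.isLocallyClosed Set.univ_nonempty
  have : Nonempty (A ⊗ B).left := ⟨Pt.val (lift a₀ b₀)⟩
  refine @IrreducibleSpace.mk _ _ ⟨?_⟩ this
  intro U V hU hV hUne hVne
  simp only [Set.univ_inter] at hUne hVne ⊢
  have hU' := (fst A B).left.isOpenMap _ hU
  have hV' := (fst A B).left.isOpenMap _ hV
  obtain ⟨a, ha, ha'⟩ := exists_val_mem A (hU'.inter hV').isLocallyClosed
    (nonempty_preirreducible_inter hU' hV' (hUne.image _) (hVne.image _))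
  let j : B ⟶ A ⊗ B := lift (toUnit B ≫ a) (𝟙 B)
  -- an open set whose projection contains `a` meets the slice `j` over `a`
  have key : ∀ W : Set (A ⊗ B).left, IsOpen W → Pt.val a ∈ (fst A B).left '' W →
      (j.left ⁻¹' W).Nonempty := by
    rintro W hW ⟨w, hw, hwa⟩
    obtain ⟨p, hpW, hpa⟩ := exists_val_mem (A ⊗ B) (hW.isLocallyClosed.inter
      (a.isClosed_val.preimage (fst A B).left.continuous).isLocallyClosed) ⟨w, hw, hwa⟩
    refine ⟨Pt.val (p ≫ snd A B), ?_⟩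
    have : p ≫ fst A B = a := Pt.ext_val hpa
    have h2 : (p ≫ snd A B) ≫ j = p := by
      apply CartesianMonoidalCategory.hom_ext
      · simp only [j, Category.assoc, lift_fst, this]
        rw [← Category.assoc, ← Category.assoc, toUnit_unique ((p ≫ snd A B) ≫ toUnit B) (𝟙 _),
          Category.id_comp]
      · simp [j]
    rw [Set.mem_preimage, ← Pt.val_comp, h2]
    exact hpW
  obtain ⟨b, hb, hb'⟩ := nonempty_preirreducible_inter (hU.preimage j.left.continuous)
    (hV.preimage j.left.continuous) (key U hU ha) (key V hV ha')
  exact ⟨j.left b, hb, hb'⟩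

/-! ### Affine charts and dimensions of images -/

/-- The spectrum of a `k`-algebra, as a `k`-scheme. -/
noncomputable abbrev specOver (k : Type u) [Field k] (R : Type u) [CommRing R] [Algebra k R] :
    Over (Spec (CommRingCat.of k)) :=
  Over.mk (Spec.map (CommRingCat.ofHom (algebraMap k R)))

section
variable {R S : Type u} [CommRing R] [CommRing S] [Algebra k R] [Algebra k S]

/-- The morphism of `k`-schemes induced by a homomorphism of `k`-algebras. -/
noncomputable def specMap (φ : S →ₐ[k] R) : specOver k R ⟶ specOver k S :=
  Over.homMk (Spec.map (CommRingCat.ofHom φ.toRingHom)) (by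
    change Spec.map _ ≫ Spec.map _ = Spec.map _
    rw [← Spec.map_comp, ← CommRingCat.ofHom_comp]
    congr 2
    exact φ.comp_algebraMap)

@[simp]
theorem specMap_left (φ : S →ₐ[k] R) :
    (specMap φ).left = Spec.map (CommRingCat.ofHom φ.toRingHom) := rfl

theorem specMap_comp {T : Type u} [CommRing T] [Algebra k T] (φ : S →ₐ[k] R) (ψ : T →ₐ[k] S) :
    specMap φ ≫ specMap ψ = specMap (φ.comp ψ) := by
  ext1
  change Spec.map _ ≫ Spec.map _ = Spec.map _
  rw [← Spec.map_comp, ← CommRingCat.ofHom_comp]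
  rfl

theorem specMap_surjective (f : specOver k R ⟶ specOver k S) : ∃ φ : S →ₐ[k] R, specMap φ = f := by
  obtain ⟨φ, hφ⟩ := Spec.map_surjective f.left
  have hw : f.left ≫ Spec.map (CommRingCat.ofHom (algebraMap k S)) =
    Spec.map (CommRingCat.ofHom (algebraMap k R)) := Over.w f
  rw [← hφ, ← Spec.map_comp] at hw
  have hw' := Spec.map_injective hw
  refine ⟨⟨φ.hom, fun c => ?_⟩, ?_⟩
  · exact congrArg (fun g => g.hom c) hw'
  · ext1
    exact hφ

theorem specMap_injective : Function.Injective (specMap : (S →ₐ[k] R) → _) := by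
  intro φ ψ h
  have := Spec.map_injective (congrArg (fun f => f.left) h)
  ext x
  exact congrArg (fun g => g.hom x) this

instance [Algebra.FiniteType k R] : LocallyOfFiniteType (specOver k R).hom := by
  change LocallyOfFiniteType (Spec.map _)
  rw [HasRingHomProperty.Spec_iff (P := @LocallyOfFiniteType)]
  exact RingHom.finiteType_algebraMap.mpr inferInstance

instance : IsSeparated (specOver k R).hom := by
  change IsSeparated (Spec.map _)
  infer_instance

instance : QuasiCompact (specOver k R).hom := by
  change QuasiCompact (Spec.map _)
  infer_instance

instance [IsDomain R] [Algebra.FiniteType k R] : IsVariety (specOver k R) where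
  isReduced := by change IsReduced (Spec _); infer_instance
  isSeparated := inferInstance
  locallyOfFiniteType := inferInstance
  quasiCompact := inferInstance

theorem topologicalKrullDim_specOver : topologicalKrullDim (specOver k R).left = ringKrullDim R :=
  PrimeSpectrum.topologicalKrullDim_eq_ringKrullDim R

end

/-- The identification of the terminal `k`-scheme with the spectrum of the `k`-algebra `k`. -/
noncomputable def unitIsoSpecOver (k : Type u) [Field k] :
    𝟙_ (Over (Spec (CommRingCat.of k))) ≅ specOver k k :=
  Over.isoMk (Iso.refl (Spec (CommRingCat.of k)))
    ((Category.id_comp _).trans (Spec.map_id (CommRingCat.of k)))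

/-- The rational point of `Spec R` given by a homomorphism from `R` to `k`. -/
noncomputable def ptOfAlgHom {R : Type u} [CommRing R] [Algebra k R] (α : R →ₐ[k] k) :
    Pt (specOver k R) :=
  (unitIsoSpecOver k).hom ≫ specMap α

theorem ptOfAlgHom_injective {R : Type u} [CommRing R] [Algebra k R] :
    Function.Injective (ptOfAlgHom : (R →ₐ[k] k) → _) := fun _ _ h =>
  specMap_injective ((cancel_epi _).mp h)

theorem ptOfAlgHom_surjective {R : Type u} [CommRing R] [Algebra k R] (p : Pt (specOver k R)) :
    ∃ α : R →ₐ[k] k, ptOfAlgHom α = p := by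
  obtain ⟨α, hα⟩ := specMap_surjective ((unitIsoSpecOver k).inv ≫ p)
  exact ⟨α, by rw [ptOfAlgHom, hα, Iso.hom_inv_id_assoc]⟩

theorem exists_affine_chart (Y : Over (Spec (CommRingCat.of k))) {y : Y.left} {W : Set Y.left}
    (hW : IsOpen W) (hy : y ∈ W) :
    ∃ (R : Type u) (_ : CommRing R) (_ : Algebra k R) (j : specOver k R ⟶ Y),
      IsOpenImmersion j.left ∧ y ∈ Set.range j.left ∧ Set.range j.left ⊆ W := by
  obtain ⟨R, f, hf, hyf, hfW⟩ := AlgebraicGeometry.Scheme.exists_affine_mem_range_and_range_subset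
    (X := Y.left) (U := ⟨W, hW⟩) hy
  obtain ⟨φ, hφ⟩ := Spec.map_surjective (f ≫ Y.hom)
  let : Algebra k R := φ.hom.toAlgebra
  exact ⟨R, inferInstance, inferInstance, Over.homMk f (by exact hφ.symm), hf, hyf, hfW⟩

theorem finiteType_of_isOpenImmersion {R : Type u} [CommRing R] [Algebra k R]
    {Y : Over (Spec (CommRingCat.of k))} (j : specOver k R ⟶ Y) [IsOpenImmersion j.left]
    [LocallyOfFiniteType Y.hom] : Algebra.FiniteType k R := by
  have : LocallyOfFiniteType (specOver k R).hom := by rw [← Over.w j]; infer_instance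
  change LocallyOfFiniteType (Spec.map _) at this
  rw [HasRingHomProperty.Spec_iff (P := @LocallyOfFiniteType)] at this
  exact RingHom.finiteType_algebraMap.mp this

theorem isDomain_of_isOpenImmersion {R : Type u} [CommRing R] [Algebra k R]
    {Y : Over (Spec (CommRingCat.of k))} (j : specOver k R ⟶ Y) [IsOpenImmersion j.left]
    [IsReduced Y.left] [IrreducibleSpace Y.left] [Nontrivial R] : IsDomain R := by
  have := isIntegral_of_irreducibleSpace_of_isReduced Y.left
  have : IsIntegral (Spec (CommRingCat.of R)) := isIntegral_of_isOpenImmersion j.left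
  exact (affine_isIntegral_iff (CommRingCat.of R)).mp this

theorem exists_fac_of_range_subset {U A Y : Over (Spec (CommRingCat.of k))} (j : U ⟶ Y)
    [IsOpenImmersion j.left] (f : A ⟶ Y) (h : Set.range f.left ⊆ Set.range j.left) :
    ∃ g : A ⟶ U, g ≫ j = f := by
  refine ⟨Over.homMk (IsOpenImmersion.lift j.left f.left h) ?_, ?_⟩
  · rw [← Over.w j, ← Category.assoc, IsOpenImmersion.lift_fac, Over.w]
  · ext1
    exact IsOpenImmersion.lift_fac _ _ _

theorem exists_affine_chart_hom {A Y : Over (Spec (CommRingCat.of k))} (f : A ⟶ Y) {S : Type u}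
    [CommRing S] [Algebra k S] (j : specOver k S ⟶ Y) [IsOpenImmersion j.left] {a : A.left}
    (ha : f.left a ∈ Set.range j.left) :
    ∃ (R : Type u) (_ : CommRing R) (_ : Algebra k R) (i : specOver k R ⟶ A) (φ : S →ₐ[k] R),
      IsOpenImmersion i.left ∧ a ∈ Set.range i.left ∧ specMap φ ≫ j = i ≫ f := by
  obtain ⟨R, _, _, i, hi, hai, hif⟩ := exists_affine_chart A
    (j.left.isOpenEmbedding.isOpen_range.preimage f.left.continuous) ha
  obtain ⟨g, hg⟩ := exists_fac_of_range_subset j (i ≫ f) (by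
    rintro _ ⟨x, rfl⟩
    exact hif ⟨x, rfl⟩)
  obtain ⟨φ, rfl⟩ := specMap_surjective g
  exact ⟨R, _, _, i, φ, hi, hai, hg⟩

section
variable {R S : Type u} [CommRing R] [CommRing S] [Algebra k R] [Algebra k S] (φ : S →ₐ[k] R)

theorem isClosedEmbedding_specMap (hφ : Function.Surjective φ) :
    Topology.IsClosedEmbedding (specMap φ).left :=
  PrimeSpectrum.isClosedEmbedding_comap_of_surjective _ φ.toRingHom hφ

theorem denseRange_specMap (hφ : Function.Injective φ) : DenseRange (specMap φ).left := by
  refine (PrimeSpectrum.denseRange_comap_iff_ker_le_nilRadical φ.toRingHom).mpr ?_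
  rw [(RingHom.injective_iff_ker_eq_bot φ.toRingHom).mp hφ]
  exact bot_le

/-- The image of a morphism of affine `k`-schemes is dense in the closed subscheme defined by the
kernel of the homomorphism of algebras. -/
theorem closure_range_specMap :
    closure (Set.range (specMap φ).left) = Set.range (specMap φ.rangeRestrict).left := by
  have hc := isClosedEmbedding_specMap φ.rangeRestrict φ.rangeRestrict_surjective
  have hd := denseRange_specMap φ.range.val Subtype.val_injective
  have : specMap φ = specMap φ.range.val ≫ specMap φ.rangeRestrict := by
    rw [specMap_comp]; rfl
  rw [this]
  change closure (Set.range ((specMap φ.rangeRestrict).left ∘ (specMap φ.range.val).left)) = _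
  rw [Set.range_comp, hc.closure_image_eq, hd.closure_range, Set.image_univ]

end

theorem closure_range_comp_of_denseRange {A B Y : Over (Spec (CommRingCat.of k))} (i : A ⟶ B)
    (f : B ⟶ Y) (hi : DenseRange i.left) :
    closure (Set.range (i ≫ f).left) = closure (Set.range f.left) := by
  change closure (Set.range (f.left ∘ i.left)) = _
  rw [Set.range_comp]
  refine (closure_mono (Set.image_subset_range _ _)).antisymm (closure_minimal ?_ isClosed_closure)
  rw [← Set.image_univ, ← hi.closure_range]
  exact image_closure_subset_closure_image f.left.continuous

/-- In an affine chart `j` of the target, the closure of the image of a morphism from an irreducible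
scheme is the closed subscheme defined by the kernel of the homomorphism of algebras that describes
the morphism in some affine chart `i` of the source. -/
theorem range_specMap_rangeRestrict_comp {A Y : Over (Spec (CommRingCat.of k))}
    [IrreducibleSpace A.left] {f : A ⟶ Y} {R S : Type u} [CommRing R] [CommRing S] [Algebra k R]
    [Algebra k S] [Nontrivial R] {φ : S →ₐ[k] R} {i : specOver k R ⟶ A} {j : specOver k S ⟶ Y}
    [IsOpenImmersion i.left] [IsOpenImmersion j.left] (h : specMap φ ≫ j = i ≫ f) :
    Set.range (specMap φ.rangeRestrict ≫ j).left =
      Set.range j.left ∩ closure (Set.range f.left) := by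
  have : Nonempty (specOver k R).left := inferInstanceAs (Nonempty (PrimeSpectrum R))
  have hi : DenseRange i.left :=
    i.left.isOpenEmbedding.isOpen_range.dense (Set.range_nonempty _)
  rw [← closure_range_comp_of_denseRange i f hi, ← h]
  change Set.range (j.left ∘ (specMap φ.rangeRestrict).left) =
    _ ∩ closure (Set.range (j.left ∘ (specMap φ).left))
  rw [Set.range_comp, Set.range_comp, ← closure_range_specMap,
    j.left.isOpenEmbedding.isEmbedding.closure_eq_preimage_closure_image,
    Set.image_preimage_eq_range_inter]

/-- The closure of the image of a morphism has at most the dimension of the source. In affine charts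
this compares the transcendence degrees of a finitely generated domain and of a subalgebra. -/
theorem topologicalKrullDim_closure_range_le {A Y : Over (Spec (CommRingCat.of k))}
    [LocallyOfFiniteType A.hom] [IsReduced A.left] [IrreducibleSpace A.left]
    [LocallyOfFiniteType Y.hom] (f : A ⟶ Y) :
    topologicalKrullDim (closure (Set.range f.left)) ≤ topologicalKrullDim A.left := by
  refine topologicalKrullDim_le_of_isOpenEmbedding ?_
  rintro ⟨y, hy⟩
  obtain ⟨S₀, _, _, j, hj, hyj, -⟩ := exists_affine_chart Y isOpen_univ (Set.mem_univ y)
  obtain ⟨_, haj, a, rfl⟩ := mem_closure_iff.mp hy _ j.left.isOpenEmbedding.isOpen_range hyj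
  obtain ⟨R, _, _, i, φ, hi, ⟨r, -⟩, hf⟩ := exists_affine_chart_hom f j haj
  have : Nontrivial R := PrimeSpectrum.nonempty_iff_nontrivial.mp ⟨r⟩
  have := isDomain_of_isOpenImmersion i
  have := finiteType_of_isOpenImmersion i
  have := finiteType_of_isOpenImmersion j
  have : Algebra.FiniteType k φ.range := .of_surjective _ φ.rangeRestrict_surjective
  let c := specMap φ.rangeRestrict ≫ j
  have hc : Set.range c.left = Set.range j.left ∩ closure (Set.range f.left) :=
    range_specMap_rangeRestrict_comp hf
  have hce : Topology.IsEmbedding c.left := j.left.isOpenEmbedding.isEmbedding.comp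
    (isClosedEmbedding_specMap φ.rangeRestrict φ.rangeRestrict_surjective).isEmbedding
  have hmem : ∀ x, c.left x ∈ closure (Set.range f.left) := fun x => (hc.le ⟨x, rfl⟩).2
  refine ⟨(specOver k φ.range).left, inferInstance, Set.codRestrict c.left _ hmem,
    ⟨hce.codRestrict _ hmem, ?_⟩, ?_, ?_⟩
  · have : Set.range (Set.codRestrict c.left _ hmem) = Subtype.val ⁻¹' Set.range j.left := by
      ext ⟨x, hx⟩
      refine ⟨?_, fun hxj => ?_⟩
      · rintro ⟨w, hw⟩
        exact (hc.le ⟨w, congrArg Subtype.val hw⟩).1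
      · obtain ⟨w, hw⟩ := hc.ge ⟨hxj, hx⟩
        exact ⟨w, Subtype.ext hw⟩
    rw [this]
    exact j.left.isOpenEmbedding.isOpen_range.preimage continuous_subtype_val
  · obtain ⟨x, hx⟩ := hc.ge ⟨hyj, hy⟩
    exact ⟨x, Subtype.ext hx⟩
  · rw [topologicalKrullDim_specOver]
    refine (ringKrullDim_le_of_algHom_injective φ.range.val Subtype.val_injective).trans ?_
    rw [← topologicalKrullDim_specOver (k := k)]
    exact i.left.isOpenEmbedding.isInducing.topologicalKrullDim_le

/-- A morphism that is injective on rational points does not lower the dimension: in affine charts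
it is given by an algebraic extension of domains. -/
theorem topologicalKrullDim_le_closure_range [IsAlgClosed k]
    {A Y : Over (Spec (CommRingCat.of k))}
    [LocallyOfFiniteType A.hom] [IsReduced A.left] [IrreducibleSpace A.left]
    [LocallyOfFiniteType Y.hom] (f : A ⟶ Y) (hf : ∀ p q : Pt A, p ≫ f = q ≫ f → p = q) :
    topologicalKrullDim A.left ≤ topologicalKrullDim (closure (Set.range f.left)) := by
  refine topologicalKrullDim_le_of_isOpenEmbedding ?_
  intro a
  obtain ⟨S₀, _, _, j, hj, haj, -⟩ := exists_affine_chart Y isOpen_univ (Set.mem_univ (f.left a))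
  obtain ⟨R, _, _, i, φ, hi, ⟨r, hr⟩, hij⟩ := exists_affine_chart_hom f j haj
  refine ⟨_, inferInstance, i.left, i.left.isOpenEmbedding, ⟨r, hr⟩, ?_⟩
  have : Nontrivial R := PrimeSpectrum.nonempty_iff_nontrivial.mp ⟨r⟩
  have := isDomain_of_isOpenImmersion i
  have := finiteType_of_isOpenImmersion i
  have := finiteType_of_isOpenImmersion j
  have : Algebra.FiniteType k φ.range := .of_surjective _ φ.rangeRestrict_surjective
  have : Algebra.IsAlgebraic φ.range R := by
    refine isAlgebraic_of_injective_algHom_comp (k := k) fun α β h => ?_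
    have hαβ : α.comp φ = β.comp φ := AlgHom.ext fun x => h ⟨φ x, x, rfl⟩
    have hi' : Mono i := Over.mono_of_mono_left i
    refine ptOfAlgHom_injective ((cancel_mono i).mp (hf _ _ ?_))
    simp only [ptOfAlgHom, Category.assoc, ← hij]
    rw [← Category.assoc (specMap α), ← Category.assoc (specMap β), specMap_comp, specMap_comp, hαβ]
  rw [topologicalKrullDim_specOver, ringKrullDim_eq_of_isAlgebraic k (R := φ.range),
    ← topologicalKrullDim_specOver (k := k)]
  let c := specMap φ.rangeRestrict ≫ j
  have hce : Topology.IsEmbedding c.left := j.left.isOpenEmbedding.isEmbedding.comp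
    (isClosedEmbedding_specMap φ.rangeRestrict φ.rangeRestrict_surjective).isEmbedding
  have hmem : ∀ x, c.left x ∈ closure (Set.range f.left) := fun x =>
    ((range_specMap_rangeRestrict_comp hij).le ⟨x, rfl⟩).2
  exact (hce.codRestrict _ hmem).isInducing.topologicalKrullDim_le

/-! ### Finite determinacy and slices -/

/-- Equality of morphisms of `k`-schemes may be verified on an open cover. -/
theorem hom_ext_of_isOpenImmersion {X Y : Over (Spec (CommRingCat.of k))} {f g : X ⟶ Y}
    (h : ∀ x : X.left, ∃ (W : Over (Spec (CommRingCat.of k))) (j : W ⟶ X), IsOpenImmersion j.left ∧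
      x ∈ Set.range j.left ∧ j ≫ f = j ≫ g) : f = g := by
  ext1
  refine Scheme.hom_ext_of_forall _ _ fun x => ?_
  obtain ⟨W, j, hj, hx, hfg⟩ := h x
  refine ⟨j.left.opensRange, hx, ?_⟩
  have : j.left.opensRange.ι = IsOpenImmersion.lift j.left j.left.opensRange.ι (by simp) ≫ j.left :=
    (IsOpenImmersion.lift_fac _ _ _).symm
  rw [this, Category.assoc, Category.assoc]
  congr 1
  exact congrArg (fun e => e.left) hfg

/-- The locus where two morphisms from an affine scheme to a separated scheme agree is defined by
an ideal. -/
theorem exists_equalizer_ideal {R : Type u} [CommRing R] [Algebra k R]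
    {Z : Over (Spec (CommRingCat.of k))} [IsSeparated Z.hom] (f g : specOver k R ⟶ Z) :
    ∃ I : Ideal R, ∀ (Q : Type u) [CommRing Q] [Algebra k Q] (χ : R →ₐ[k] Q),
      specMap χ ≫ f = specMap χ ≫ g ↔ I ≤ RingHom.ker χ := by
  obtain ⟨I, e, he⟩ := IsClosedImmersion.Spec_iff.mp
    (isClosedImmersion_equalizer_ι_left f g)
  have hI : specMap (Ideal.Quotient.mkₐ k I) ≫ f = specMap (Ideal.Quotient.mkₐ k I) ≫ g := by
    ext1
    have h1 : (Limits.equalizer.ι f g).left ≫ f.left = (Limits.equalizer.ι f g).left ≫ g.left := by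
      rw [← Over.comp_left, Limits.equalizer.condition, Over.comp_left]
    rw [he, Category.assoc, Category.assoc, cancel_epi] at h1
    exact h1
  refine ⟨I, fun Q _ _ χ => ⟨fun h => ?_, fun h => ?_⟩⟩
  · have hl := Limits.equalizer.lift_ι _ h
    have h2 : (Limits.equalizer.lift _ h).left ≫ (Limits.equalizer.ι f g).left =
        (specMap χ).left := by
      rw [← Over.comp_left, hl]
    rw [he, ← Category.assoc] at h2
    obtain ⟨ψ, hψ⟩ := Spec.map_surjective ((Limits.equalizer.lift _ h).left ≫ e.hom)
    rw [← hψ, specMap_left, ← Spec.map_comp] at h2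
    have h3 := Spec.map_injective h2
    intro x hx
    have h4 := congrArg (fun (m : CommRingCat.of R ⟶ CommRingCat.of Q) => m.hom x) h3
    have h5 : Ideal.Quotient.mk I x = 0 := Ideal.Quotient.eq_zero_iff_mem.mpr hx
    simp only [CommRingCat.hom_comp, CommRingCat.hom_ofHom, RingHom.comp_apply, h5, map_zero] at h4
    exact h4.symm
  · have : χ = (Ideal.Quotient.liftₐ I χ fun a ha => h ha).comp (Ideal.Quotient.mkₐ k I) := by
      ext x; rfl
    rw [this, ← specMap_comp, Category.assoc, Category.assoc, hI]

/-- Let `R` be a finitely generated `k`-algebra. A family of morphisms from `Spec R` to separated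
schemes has a finite subfamily such that two points of `Spec R`, with values in any algebra, that
have the same image under the subfamily have the same image under the whole family. -/
theorem exists_finset_forall_specMap_comp_eq {R : Type u} [CommRing R] [Algebra k R]
    [Algebra.FiniteType k R] {ι : Type*} {Z : ι → Over (Spec (CommRingCat.of k))}
    [∀ i, IsSeparated (Z i).hom] (f : ∀ i, specOver k R ⟶ Z i) :
    ∃ s : Finset ι, ∀ (Q : Type u) [CommRing Q] [Algebra k Q] (p q : R →ₐ[k] Q),
      (∀ i ∈ s, specMap p ≫ f i = specMap q ≫ f i) → ∀ i, specMap p ≫ f i = specMap q ≫ f i := by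
  -- the locus in `Spec (R ⊗ R)` where the `i`-th morphism agrees on both components
  choose I hI using fun i => exists_equalizer_ideal
    (specMap (Algebra.TensorProduct.includeLeft : R →ₐ[k] TensorProduct k R R) ≫ f i)
    (specMap Algebra.TensorProduct.includeRight ≫ f i)
  have : Algebra.FiniteType k (TensorProduct k R R) := .trans (S := R) inferInstance inferInstance
  have : IsNoetherianRing (TensorProduct k R R) := Algebra.FiniteType.isNoetherianRing k _
  -- finitely many of the ideals `I i` generate their supremum, as `R ⊗ R` is noetherian
  obtain ⟨s, hs⟩ := CompleteLattice.IsCompactElement.exists_finset_of_le_iSup _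
    ((Submodule.fg_iff_compact (⨆ i, I i)).mp (IsNoetherian.noetherian _)) I le_rfl
  refine ⟨s, fun Q _ _ p q h i => ?_⟩
  let χ : TensorProduct k R R →ₐ[k] Q := Algebra.TensorProduct.lift p q fun _ _ => .all _ _
  have hp : χ.comp Algebra.TensorProduct.includeLeft = p :=
    Algebra.TensorProduct.lift_comp_includeLeft _ _ fun _ _ => .all _ _
  have hq : χ.comp Algebra.TensorProduct.includeRight = q :=
    Algebra.TensorProduct.lift_comp_includeRight _ _ fun _ _ => .all _ _
  have key : ∀ i, specMap p ≫ f i = specMap q ≫ f i ↔ I i ≤ RingHom.ker χ := by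
    intro i
    rw [← hI, ← Category.assoc, ← Category.assoc, specMap_comp, specMap_comp, hp, hq]
  rw [key]
  refine ((le_iSup I i).trans hs).trans (iSup₂_le fun j hj => (key j).mp (h j hj))

/-- The canonical morphism from the spectrum of a tensor product of algebras to the product of the
spectra, an isomorphism. -/
noncomputable def specTensorHom (R S : Type u) [CommRing R] [CommRing S] [Algebra k R]
    [Algebra k S] : specOver k (TensorProduct k R S) ⟶ specOver k R ⊗ specOver k S :=
  lift (specMap Algebra.TensorProduct.includeLeft) (specMap Algebra.TensorProduct.includeRight)

instance (R S : Type u) [CommRing R] [CommRing S] [Algebra k R]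
    [Algebra k S] : IsIso (specTensorHom (k := k) R S) := by
  have : (specTensorHom (k := k) R S).left = (pullbackSpecIso k R S).inv := by
    apply Limits.pullback.hom_ext
    · refine Eq.trans ?_ (pullbackSpecIso_inv_fst k R S).symm
      exact congrArg (fun e => e.left) (lift_fst (specMap Algebra.TensorProduct.includeLeft)
        (specMap (Algebra.TensorProduct.includeRight : S →ₐ[k] TensorProduct k R S)))
    · refine Eq.trans ?_ (pullbackSpecIso_inv_snd k R S).symm
      exact congrArg (fun e => e.left) (lift_snd (specMap Algebra.TensorProduct.includeLeft)
        (specMap (Algebra.TensorProduct.includeRight : S →ₐ[k] TensorProduct k R S)))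
  have : IsIso (specTensorHom (k := k) R S).left := by rw [this]; infer_instance
  have : IsIso ((Over.forget _).map (specTensorHom (k := k) R S)) := this
  exact isIso_of_reflects_iso _ (Over.forget _)

/-- Functions on `Spec (Q ⊗ R)`, where `R` is reduced, are separated by the rational points of
`Spec R`. -/
theorem eq_zero_of_forall_algHom [IsAlgClosed k] {Q R : Type u} [CommRing Q] [CommRing R]
    [Algebra k Q] [Algebra k R] [Algebra.FiniteType k R] [IsReduced R]
    (x : TensorProduct k Q R)
    (h : ∀ α : R →ₐ[k] k, Algebra.TensorProduct.lift (AlgHom.id k Q)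
      ((Algebra.ofId k Q).comp α) (fun _ _ => .all _ _) x = 0) : x = 0 := by
  classical
  -- coordinates with respect to a basis of `Q` over `k` reduce the claim to functions on `Spec R`
  let b := Module.Basis.ofVectorSpace k Q
  let e := TensorProduct.equivFinsuppOfBasisLeft (N := R) b
  have key : ∀ (α : R →ₐ[k] k) (i) (x : TensorProduct k Q R),
      b.repr (Algebra.TensorProduct.lift (AlgHom.id k Q)
        ((Algebra.ofId k Q).comp α) (fun _ _ => .all _ _) x) i = α (e x i) := by
    intro α i x
    induction x with
    | zero => simp
    | add x y hx hy => simp [hx, hy]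
    | tmul q r =>
      simp only [Algebra.TensorProduct.lift_tmul, AlgHom.coe_id, id_eq, AlgHom.comp_apply,
        Algebra.ofId_apply, e, TensorProduct.equivFinsuppOfBasisLeft_apply_tmul_apply]
      rw [mul_comm, ← Algebra.smul_def]
      simp [mul_comm]
  refine e.injective (Finsupp.ext fun i => ?_)
  rw [map_zero, Finsupp.zero_apply]
  by_contra hne
  obtain ⟨α, hα⟩ := exists_algHom_apply_ne_zero (k := k) hne
  exact hα (by rw [← key, h α, map_zero, Finsupp.zero_apply])

theorem specMap_lift_comp_specTensorHom {Q R : Type u} [CommRing Q] [CommRing R]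
    [Algebra k Q] [Algebra k R] (α : R →ₐ[k] k) :
    specMap (Algebra.TensorProduct.lift (AlgHom.id k Q)
      ((Algebra.ofId k Q).comp α) (fun _ _ => .all _ _)) ≫ specTensorHom Q R =
    lift (𝟙 _) (toUnit _ ≫ ptOfAlgHom α) := by
  have h : (Algebra.TensorProduct.lift (AlgHom.id k Q) ((Algebra.ofId k Q).comp α)
      fun _ _ => .all _ _).comp Algebra.TensorProduct.includeRight = (Algebra.ofId k Q).comp α :=
    Algebra.TensorProduct.lift_comp_includeRight _ _ fun _ _ => .all _ _
  rw [specTensorHom, comp_lift, specMap_comp, specMap_comp,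
    Algebra.TensorProduct.lift_comp_includeLeft, h,
    ← specMap_comp, ptOfAlgHom, ← Category.assoc]
  have h1 : specMap (AlgHom.id k Q) = 𝟙 _ := by
    ext1
    exact Spec.map_id _
  have h2 : toUnit _ ≫ (unitIsoSpecOver k).hom = specMap (Algebra.ofId k Q) := by
    rw [← cancel_mono (unitIsoSpecOver k).inv, Category.assoc, Iso.hom_inv_id]
    exact toUnit_unique _ _
  rw [h1, h2]

/-- Two morphisms from `Spec Q × X` to a separated scheme, where `X` is reduced, are equal if they
agree on `Spec Q × {u}` for every rational point `u` of `X`. The algebra `Q` need not be reduced. -/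
theorem hom_ext_of_forall_pt_slice [IsAlgClosed k] {Q : Type u} [CommRing Q] [Algebra k Q]
    {X Z : Over (Spec (CommRingCat.of k))} [LocallyOfFiniteType X.hom] [IsReduced X.left]
    [IsSeparated Z.hom] {f g : specOver k Q ⊗ X ⟶ Z}
    (h : ∀ u : Pt X, lift (𝟙 _) (toUnit _ ≫ u) ≫ f = lift (𝟙 _) (toUnit _ ≫ u) ≫ g) : f = g := by
  refine hom_ext_of_isOpenImmersion fun x => ?_
  obtain ⟨R, _, _, j, hj, hx, -⟩ := exists_affine_chart X isOpen_univ
    (Set.mem_univ ((snd (specOver k Q) X).left x))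
  have := finiteType_of_isOpenImmersion j
  have : IsReduced (Spec (CommRingCat.of R)) := isReduced_of_isOpenImmersion j.left
  have : _root_.IsReduced R := (affine_isReduced_iff (CommRingCat.of R)).mp this
  -- the charts `Spec Q × Spec R = Spec (Q ⊗ R)`, for affine charts `Spec R` of `X`
  let c : specOver k (TensorProduct k Q R) ⟶ specOver k Q ⊗ X := specTensorHom Q R ≫ _ ◁ j
  have hiso : IsIso (specTensorHom (k := k) Q R).left :=
    inferInstanceAs (IsIso ((Over.forget _).map (specTensorHom (k := k) Q R)))
  have hwj : IsOpenImmersion (specOver k Q ◁ j).left := by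
    rw [Over.whiskerLeft_left]
    infer_instance
  refine ⟨_, c, ?_, ?_, ?_⟩
  · rw [Over.comp_left]
    infer_instance
  · have h1 : x ∈ Set.range (specOver k Q ◁ j).left := by
      rw [Over.whiskerLeft_left, Scheme.Pullback.range_map]
      exact ⟨⟨_, rfl⟩, hx⟩
    obtain ⟨y, hy⟩ := h1
    obtain ⟨z, rfl⟩ := (specTensorHom (k := k) Q R).left.surjective y
    exact ⟨z, hy⟩
  · obtain ⟨I, hI⟩ := exists_equalizer_ideal (c ≫ f) (c ≫ g)
    have hI0 : I ≤ RingHom.ker (AlgHom.id k (TensorProduct k Q R)) := by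
      intro x hxI
      refine eq_zero_of_forall_algHom x fun α => ?_
      refine (hI Q _).mp ?_ hxI
      have : specMap (Algebra.TensorProduct.lift (AlgHom.id k Q)
          ((Algebra.ofId k Q).comp α) (fun _ _ => .all _ _)) ≫ c =
          lift (𝟙 _) (toUnit _ ≫ ptOfAlgHom α ≫ j) := by
        simp only [c]
        rw [← Category.assoc, specMap_lift_comp_specTensorHom]
        simp
      refine ((Category.assoc _ c f).symm.trans ?_).trans (Category.assoc _ c g)
      rw [this]
      exact h _
    have := (hI _ (AlgHom.id k _)).mpr hI0
    have hid : specMap (AlgHom.id k (TensorProduct k Q R)) = 𝟙 _ := by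
      ext1
      exact Spec.map_id _
    rwa [hid, Category.id_comp, Category.id_comp] at this

/-! ### Powers, descent of morphisms and evaluation of families -/

theorem locallyOfFiniteType_hom_of_isIso {P Q : Over (Spec (CommRingCat.of k))} (e : P ⟶ Q)
    [IsIso e] [LocallyOfFiniteType Q.hom] : LocallyOfFiniteType P.hom := by
  have : IsIso e.left := inferInstanceAs (IsIso ((Over.forget _).map e))
  rw [← Over.w e]
  infer_instance

/-- The power of a `k`-scheme indexed by `Option ι` is obtained from the power indexed by `ι` by
adding a factor. -/
noncomputable def powerOptionIso (X : Over (Spec (CommRingCat.of k))) (ι : Type u) [Finite ι] :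
    (∏ᶜ fun _ : Option ι => X) ≅ X ⊗ (∏ᶜ fun _ : ι => X) where
  hom := lift (Limits.Pi.π _ none) (Limits.Pi.lift fun a => Limits.Pi.π _ (some a))
  inv := Limits.Pi.lift fun
    | none => fst _ _
    | some a => snd _ _ ≫ Limits.Pi.π _ a
  hom_inv_id := by
    apply Limits.Pi.hom_ext
    rintro (_ | a) <;> simp
  inv_hom_id := by
    apply CartesianMonoidalCategory.hom_ext
    · simp
    · apply Limits.Pi.hom_ext
      intro a
      simp

instance locallyOfFiniteType_power (X : Over (Spec (CommRingCat.of k)))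
    [LocallyOfFiniteType X.hom] (ι : Type u) [Finite ι] :
    LocallyOfFiniteType (∏ᶜ fun _ : ι => X).hom := by
  refine Finite.induction_empty_option (P := fun ι => ∀ [Finite ι],
    LocallyOfFiniteType (∏ᶜ fun _ : ι => X).hom) ?_ ?_ ?_ ι
  · intro α β e h _
    have : Finite α := .of_equiv β e.symm
    have := @h _
    exact locallyOfFiniteType_hom_of_isIso (Limits.Pi.whiskerEquiv (f := fun _ : α => X)
      (g := fun _ : β => X) e fun _ => Iso.refl X).inv
  · intro _
    let e : (∏ᶜ fun _ : PEmpty.{u + 1} => X) ≅ 𝟙_ _ :=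
      ⟨toUnit _, Limits.Pi.lift fun i => i.elim, Limits.Pi.hom_ext _ _ fun i => i.elim,
        toUnit_unique _ _⟩
    have : LocallyOfFiniteType (𝟙_ (Over (Spec (CommRingCat.of k)))).hom := by
      change LocallyOfFiniteType (𝟙 _)
      infer_instance
    have : IsIso e.hom := e.isIso_hom
    exact locallyOfFiniteType_hom_of_isIso e.hom
  · intro α _ h _
    have := @h _
    have : LocallyOfFiniteType (X ⊗ (∏ᶜ fun _ : α => X)).hom := by
      rw [Over.tensorObj_hom]
      infer_instance
    exact locallyOfFiniteType_hom_of_isIso (powerOptionIso X α).hom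

/-- Morphisms of `k`-schemes descend along faithfully flat quasi-compact morphisms; it suffices to
verify the descent condition on points with values in algebras. -/
theorem exists_fac_of_flat {A B Y : Over (Spec (CommRingCat.of k))} (π : A ⟶ B)
    [QuasiCompact π.left] [Surjective π.left] [Flat π.left] (e : A ⟶ Y)
    (h : ∀ (Q : Type u) [CommRing Q] [Algebra k Q] (g₁ g₂ : specOver k Q ⟶ A),
      g₁ ≫ π = g₂ ≫ π → g₁ ≫ e = g₂ ≫ e) : ∃ f : B ⟶ Y, π ≫ f = e := by
  have key : ∀ {Z : Scheme} (g₁ g₂ : Z ⟶ A.left), g₁ ≫ π.left = g₂ ≫ π.left →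
      g₁ ≫ e.left = g₂ ≫ e.left := by
    intro Z g₁ g₂ hg
    let G₁ : Over.mk (g₁ ≫ A.hom) ⟶ A := Over.homMk g₁ rfl
    let G₂ : Over.mk (g₁ ≫ A.hom) ⟶ A := Over.homMk g₂ (by
      change g₂ ≫ A.hom = g₁ ≫ A.hom
      rw [← Over.w π, ← Category.assoc, ← Category.assoc, hg])
    have hG : G₁ ≫ π = G₂ ≫ π := by
      ext1
      exact hg
    suffices hs : G₁ ≫ e = G₂ ≫ e from congrArg (fun m => m.left) hs
    refine hom_ext_of_isOpenImmersion fun z => ?_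
    obtain ⟨Q, _, _, j, hj, hz, -⟩ := exists_affine_chart _ isOpen_univ (Set.mem_univ z)
    refine ⟨_, j, hj, hz, ?_⟩
    have := h Q (j ≫ G₁) (j ≫ G₂) (by rw [Category.assoc, hG, Category.assoc])
    rwa [Category.assoc, Category.assoc] at this
  have hfac := EffectiveEpi.fac π.left e.left key
  refine ⟨Over.homMk (EffectiveEpi.desc π.left e.left key) ?_, ?_⟩
  · rw [← cancel_epi π.left, ← Category.assoc, hfac, Over.w, Over.w]
  · ext1
    exact hfac

/-- Evaluation at the rational point `u` of `X` of a family `Φ` of endomorphisms of `X`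
parametrized by `A`. -/
noncomputable def evalAt {A X : Over (Spec (CommRingCat.of k))} (Φ : A ⊗ X ⟶ X) (u : Pt X) :
    A ⟶ X :=
  lift (𝟙 A) (toUnit A ≫ u) ≫ Φ

/-- Simultaneous evaluation at the rational points in a finite set `s` of a family `Φ` of
endomorphisms of `X` parametrized by `A`. -/
noncomputable def evalMap {A X : Over (Spec (CommRingCat.of k))} (Φ : A ⊗ X ⟶ X)
    (s : Finset (Pt X)) : A ⟶ ∏ᶜ fun _ : s => X :=
  Limits.Pi.lift fun u => evalAt Φ u.1

section
variable {A B X : Over (Spec (CommRingCat.of k))} (Φ : A ⊗ X ⟶ X)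

theorem comp_evalAt (u : Pt X) (f : B ⟶ A) :
    f ≫ evalAt Φ u = lift f (toUnit B ≫ u) ≫ Φ := by
  rw [evalAt, ← Category.assoc, comp_lift, Category.comp_id, ← Category.assoc,
    toUnit_unique (f ≫ toUnit A) (toUnit B)]

theorem evalAt_whiskerRight (u : Pt X) (f : B ⟶ A) : evalAt (f ▷ X ≫ Φ) u = f ≫ evalAt Φ u := by
  rw [comp_evalAt, evalAt, ← Category.assoc, lift_whiskerRight, Category.id_comp]

theorem evalMap_π (s : Finset (Pt X)) (u : s) : evalMap Φ s ≫ Limits.Pi.π _ u = evalAt Φ u.1 :=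
  Limits.Pi.lift_π _ _

theorem evalMap_whiskerRight (s : Finset (Pt X)) (f : B ⟶ A) :
    evalMap (f ▷ X ≫ Φ) s = f ≫ evalMap Φ s := by
  refine Limits.Pi.hom_ext _ _ fun u => ?_
  rw [Category.assoc, evalMap_π, evalMap_π, evalAt_whiskerRight]

theorem pt_comp_evalAt {ρ : Pt A → Aut X} (h : ∀ a x, lift a x ≫ Φ = x ≫ (ρ a).hom) (a : Pt A)
    (u : Pt X) : a ≫ evalAt Φ u = u ≫ (ρ a).hom := by
  rw [comp_evalAt, toUnit_unique (toUnit (𝟙_ (Over (Spec (CommRingCat.of k))))) (𝟙 _),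
    Category.id_comp, h]

end

theorem le_dimSubgroup {A X : Over (Spec (CommRingCat.of k))} {G : Subgroup (Aut X)} [IsVariety A]
    [IrreducibleSpace A.left] {ρ : Pt A → Aut X} (hρ : IsMorphismToAut ρ)
    (hinj : Function.Injective ρ) (hG : ∀ a, ρ a ∈ G) :
    topologicalKrullDim A.left ≤ dimSubgroup G :=
  le_sSup ⟨A, ρ, ‹_›, ‹_›, hρ, hinj, hG, rfl⟩

/-- An irreducible scheme locally of finite type admits a dominant morphism from an affine variety:
the reduction of a nonempty affine open subscheme. -/
theorem exists_domain_dense_specMap (B : Over (Spec (CommRingCat.of k)))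
    [LocallyOfFiniteType B.hom] [IrreducibleSpace B.left] :
    ∃ (R : Type u) (_ : CommRing R) (_ : Algebra k R) (i : specOver k R ⟶ B),
      IsDomain R ∧ Algebra.FiniteType k R ∧ DenseRange i.left := by
  obtain ⟨R, _, _, i, hi, ⟨r, -⟩, -⟩ := exists_affine_chart B isOpen_univ
    (Set.mem_univ (Classical.arbitrary B.left))
  have := finiteType_of_isOpenImmersion i
  have : Nonempty (specOver k R).left := ⟨r⟩
  have hd : DenseRange i.left :=
    i.left.isOpenEmbedding.isOpen_range.dense ⟨_, r, rfl⟩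
  have : IrreducibleSpace (PrimeSpectrum R) :=
    i.left.isOpenEmbedding.irreducibleSpace
  have : (nilradical R).IsPrime := PrimeSpectrum.irreducibleSpace_iff_isPrime_nilradical.mp this
  -- dividing by the nilradical changes neither the points nor the image
  refine ⟨R ⧸ nilradical R, inferInstance, inferInstance,
    specMap (Ideal.Quotient.mkₐ k (nilradical R)) ≫ i, inferInstance, inferInstance, ?_⟩
  have hd' : DenseRange (specMap (Ideal.Quotient.mkₐ k (nilradical R))).left := by
    refine (PrimeSpectrum.denseRange_comap_iff_ker_le_nilRadical _).mpr ?_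
    exact (Ideal.mk_ker (I := nilradical R)).le
  exact hd.comp hd' i.left.continuous

/-! ### Descent of families of automorphisms -/

theorem isPullback_whiskerRight_left {A B : Over (Spec (CommRingCat.of k))} (f : A ⟶ B)
    (X : Over (Spec (CommRingCat.of k))) :
    IsPullback (Limits.pullback.fst A.hom X.hom) (f ▷ X).left f.left
      (Limits.pullback.fst B.hom X.hom) := by
  refine (IsPullback.of_right (h₁₁ := (f ▷ X).left) (h₁₂ := Limits.pullback.snd B.hom X.hom)
    (h₂₁ := f.left) (h₂₂ := B.hom) (v₁₃ := X.hom) ?_ (Over.whiskerRight_left_fst f)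
    (IsPullback.of_hasPullback B.hom X.hom).flip).flip
  rw [Over.whiskerRight_left_snd, Over.w]
  exact (IsPullback.of_hasPullback A.hom X.hom).flip

/-- Let `Spec R' → Spec S'` be a finite free cover. A family of automorphisms of `X` parametrized by
`Spec R'` descends to `Spec S'` if its values at the finitely many points in `s` are pulled back
from `Spec S'` and determine, for points with values in any algebra, its values at all points of
`X`. The descended family is injective if `Spec S'` is mapped injectively to the power of `X`. -/
theorem exists_injective_family_of_finite_free [IsAlgClosed k]
    {X : Over (Spec (CommRingCat.of k))} [IsVariety X] {S' R' : Type u}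
    [CommRing S'] [CommRing R'] [Algebra k S'] [Algebra k R'] [Algebra S' R']
    [IsScalarTower k S' R'] [Module.Finite S' R'] [Module.Free S' R']
    (hinj : Function.Injective (algebraMap S' R'))
    {Φ : specOver k R' ⊗ X ⟶ X} {ρ : Pt (specOver k R') → Aut X}
    (hρ : ∀ a x, lift a x ≫ Φ = x ≫ (ρ a).hom) {s : Finset (Pt X)}
    (hs : ∀ (Q : Type u) [CommRing Q] [Algebra k Q] (p q : specOver k Q ⟶ specOver k R'),
      (∀ u ∈ s, p ≫ evalAt Φ u = q ≫ evalAt Φ u) → ∀ u, p ≫ evalAt Φ u = q ≫ evalAt Φ u)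
    {m : specOver k S' ⟶ ∏ᶜ fun _ : s => X}
    (hm : specMap (IsScalarTower.toAlgHom k S' R') ≫ m = evalMap Φ s)
    (hm_inj : ∀ c c' : Pt (specOver k S'), c ≫ m = c' ≫ m → c = c') :
    ∃ ρ₀ : Pt (specOver k S') → Aut X, IsMorphismToAut ρ₀ ∧ Function.Injective ρ₀ ∧
      ∀ c, ∃ a, ρ₀ c = ρ a := by
  have := IsVariety.isSeparated (X := X)
  have := IsVariety.locallyOfFiniteType (X := X)
  have := IsVariety.isReduced (X := X)
  let π : specOver k R' ⟶ specOver k S' := specMap (IsScalarTower.toAlgHom k S' R')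
  have hflat : Flat π.left := by
    change Flat (Spec.map _)
    rw [HasRingHomProperty.Spec_iff (P := @Flat)]
    exact RingHom.flat_algebraMap_iff.mpr inferInstance
  have hqc : QuasiCompact π.left := by
    change QuasiCompact (Spec.map _)
    infer_instance
  have hsurj : Surjective π.left :=
    ⟨PrimeSpectrum.comap_surjective_iff_injective_of_finite.mpr hinj⟩
  have : Flat (π ▷ X).left :=
    MorphismProperty.of_isPullback (isPullback_whiskerRight_left π X) hflat
  have : QuasiCompact (π ▷ X).left :=
    MorphismProperty.of_isPullback (isPullback_whiskerRight_left π X) hqc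
  have : Surjective (π ▷ X).left :=
    MorphismProperty.of_isPullback (isPullback_whiskerRight_left π X) hsurj
  have hev (u : s) : evalAt Φ u.1 = π ≫ m ≫ Limits.Pi.π _ u := by
    rw [← evalMap_π, ← hm, Category.assoc]
  -- the descent condition: two `Q`-points of `Spec R'` with the same image in `Spec S'` have the
  -- same values at `s`, hence at all points of `X`, and so define the same family over `Spec Q`
  obtain ⟨Φ₀, hΦ₀⟩ := exists_fac_of_flat (π ▷ X) Φ fun Q _ _ g₁ g₂ hg => by
    have hfst : (g₁ ≫ fst _ _) ≫ π = (g₂ ≫ fst _ _) ≫ π := by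
      simpa using hg =≫ fst _ _
    have hsnd : g₁ ≫ snd _ _ = g₂ ≫ snd _ _ := by
      simpa using hg =≫ snd _ _
    have key : (g₁ ≫ fst _ _) ▷ X ≫ Φ = (g₂ ≫ fst _ _) ▷ X ≫ Φ := by
      refine hom_ext_of_forall_pt_slice fun u => ?_
      have := hs Q (g₁ ≫ fst _ _) (g₂ ≫ fst _ _) (fun u hu => by
        rw [hev ⟨u, hu⟩, ← Category.assoc _ π, hfst, Category.assoc]) u
      rw [← evalAt_whiskerRight, ← evalAt_whiskerRight] at this
      exact this
    have h₁ : lift (𝟙 _) (g₁ ≫ snd _ _) ≫ (g₁ ≫ fst _ _) ▷ X = g₁ := by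
      rw [lift_whiskerRight, Category.id_comp, ← comp_lift, lift_fst_snd, Category.comp_id]
    have h₂ : lift (𝟙 _) (g₁ ≫ snd _ _) ≫ (g₂ ≫ fst _ _) ▷ X = g₂ := by
      rw [hsnd, lift_whiskerRight, Category.id_comp, ← comp_lift, lift_fst_snd, Category.comp_id]
    rw [← h₁, Category.assoc, key, ← Category.assoc, h₂]
  have hlift (c : Pt (specOver k S')) : ∃ b : Pt (specOver k R'), b ≫ π = c := by
    obtain ⟨χ, rfl⟩ := ptOfAlgHom_surjective c
    obtain ⟨θ, hθ⟩ := exists_ringHom_comp_algebraMap_eq_of_isIntegral hinj χ.toRingHom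
    let θ' : R' →ₐ[k] k := ⟨θ, fun a => by
      rw [IsScalarTower.algebraMap_apply k S' R']
      exact (congrArg (fun f => f (algebraMap k S' a)) hθ).trans (χ.commutes a)⟩
    refine ⟨ptOfAlgHom θ', ?_⟩
    rw [ptOfAlgHom, Category.assoc, specMap_comp, ptOfAlgHom]
    congr 2
    ext x
    exact congrArg (fun f => f x) hθ
  choose b hb using hlift
  refine ⟨fun c => ρ (b c), ⟨Φ₀, fun c x => ?_⟩, fun c c' h => ?_, fun c => ⟨b c, rfl⟩⟩
  · rw [← hρ, ← hΦ₀, ← Category.assoc, lift_whiskerRight, hb]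
  · refine hm_inj _ _ (Limits.Pi.hom_ext _ _ fun u => ?_)
    have h' : ∀ c, c ≫ m ≫ Limits.Pi.π _ u = u.1 ≫ (ρ (b c)).hom := fun c => by
      rw [← pt_comp_evalAt Φ hρ, hev]
      exact ((Category.assoc _ _ _).symm.trans (congrArg (· ≫ _) (hb c))).symm
    rw [Category.assoc, Category.assoc, h', h']
    exact congrArg (fun g : Aut X => u.1 ≫ g.hom) h

/-- The values at a suitable finite set of points of an irreducible, not necessarily injective
family in `G` sweep out a set of dimension at most `dim G`. A dense part of the closure of the image
is the parameter space of an injective family in `G`, obtained by descent along a quasi-section. -/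
theorem exists_finset_topologicalKrullDim_closure_range_evalMap_le [IsAlgClosed k]
    {X : Over (Spec (CommRingCat.of k))} [IsVariety X] {G : Subgroup (Aut X)}
    {B : Over (Spec (CommRingCat.of k))} [LocallyOfFiniteType B.hom] [IrreducibleSpace B.left]
    {Φ : B ⊗ X ⟶ X} {ρ : Pt B → Aut X} (hρ : ∀ b x, lift b x ≫ Φ = x ≫ (ρ b).hom)
    (hG : ∀ b, ρ b ∈ G) (s₀ : Finset (Pt X)) :
    ∃ s : Finset (Pt X), s₀ ⊆ s ∧
      topologicalKrullDim (closure (Set.range (evalMap Φ s).left)) ≤ dimSubgroup G := by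
  classical
  have := IsVariety.isSeparated (X := X)
  have := IsVariety.locallyOfFiniteType (X := X)
  obtain ⟨R₁, _, _, i₁, _, _, hi₁⟩ := exists_domain_dense_specMap B
  obtain ⟨t, ht⟩ := exists_finset_forall_specMap_comp_eq fun u => i₁ ≫ evalAt Φ u
  let s := t ∪ s₀
  have hs : ∀ (Q : Type u) [CommRing Q] [Algebra k Q] (p q : specOver k Q ⟶ specOver k R₁),
      (∀ u ∈ s, p ≫ i₁ ≫ evalAt Φ u = q ≫ i₁ ≫ evalAt Φ u) →
      ∀ u, p ≫ i₁ ≫ evalAt Φ u = q ≫ i₁ ≫ evalAt Φ u := by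
    intro Q _ _ p q h
    obtain ⟨p, rfl⟩ := specMap_surjective p
    obtain ⟨q, rfl⟩ := specMap_surjective q
    exact ht Q p q fun u hu => h u (Finset.mem_union_left _ hu)
  refine ⟨s, Finset.subset_union_right, ?_⟩
  have : IrreducibleSpace (specOver k R₁).left :=
    inferInstanceAs (IrreducibleSpace (PrimeSpectrum R₁))
  have : IsReduced (specOver k R₁).left := inferInstanceAs (IsReduced (Spec _))
  let ev := i₁ ≫ evalMap Φ s
  let x₁ : (specOver k R₁).left := Classical.arbitrary _
  obtain ⟨S₀, _, _, j, hj, hyj, -⟩ := exists_affine_chart (∏ᶜ fun _ : s => X) isOpen_univ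
    (Set.mem_univ (ev.left x₁))
  obtain ⟨R, _, _, i, φ, hi, ⟨r, -⟩, hij⟩ := exists_affine_chart_hom ev j hyj
  have : Nontrivial R := PrimeSpectrum.nonempty_iff_nontrivial.mp ⟨r⟩
  have := isDomain_of_isOpenImmersion i
  have := finiteType_of_isOpenImmersion i
  have := finiteType_of_isOpenImmersion j
  let S := φ.range
  have : Algebra.FiniteType k S := .of_surjective _ φ.rangeRestrict_surjective
  have : IsNoetherianRing S := Algebra.FiniteType.isNoetherianRing k _
  have : Algebra.FiniteType S R := .of_restrictScalars_finiteType k S R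
  -- `Spec S` is a chart of the closure of the image, `Spec S'` is an open subset of it, and `θ`
  -- lifts a finite free cover `Spec R'` of `Spec S'` to the parameter space
  obtain ⟨f, hf, S', R', _, _, _, _, _, _, hloc, _, _, hinj, ⟨θ⟩⟩ :=
    exists_finite_free_localization (S := S) (R := R) Subtype.val_injective
  let : Algebra k S' := Algebra.compHom S' (algebraMap k S)
  let : Algebra k R' := Algebra.compHom R' (algebraMap k S)
  have : IsScalarTower k S S' := .of_algebraMap_eq fun _ => rfl
  have : IsScalarTower k S R' := .of_algebraMap_eq fun _ => rfl
  have : IsScalarTower k S' R' := .of_algebraMap_eq fun a => by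
    rw [IsScalarTower.algebraMap_apply k S R', IsScalarTower.algebraMap_apply k S S',
      ← IsScalarTower.algebraMap_apply S S' R']
  have hle : Submonoid.powers f ≤ nonZeroDivisors S :=
    powers_le_nonZeroDivisors_of_noZeroDivisors hf
  have : IsDomain S' := IsLocalization.isDomain_of_le_nonZeroDivisors (R := S) S' hle
  have : Algebra.FiniteType S S' := IsLocalization.finiteType_of_monoid_fg (.powers f) S'
  have : Algebra.FiniteType k S' := .trans (S := S) inferInstance inferInstance
  let l : S →ₐ[k] S' := IsScalarTower.toAlgHom k S S'
  have hl : Function.Injective l := IsLocalization.injective S' hle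
  let m : specOver k S' ⟶ ∏ᶜ fun _ : s => X := specMap l ≫ specMap φ.rangeRestrict ≫ j
  have hm_inj : ∀ c c' : Pt (specOver k S'), c ≫ m = c' ≫ m → c = c' := by
    intro c c' h
    obtain ⟨γ, rfl⟩ := ptOfAlgHom_surjective c
    obtain ⟨γ', rfl⟩ := ptOfAlgHom_surjective c'
    have hmono : Mono j := Over.mono_of_mono_left j
    simp only [ptOfAlgHom, m, Category.assoc, cancel_epi] at h
    rw [← Category.assoc, ← Category.assoc, ← Category.assoc, ← Category.assoc, cancel_mono,
      specMap_comp, specMap_comp, specMap_comp, specMap_comp] at h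
    have h' := specMap_injective h
    congr 1
    refine IsLocalization.algHom_ext (Submonoid.powers f) (AlgHom.ext fun x => ?_)
    obtain ⟨y, rfl⟩ := φ.rangeRestrict_surjective x
    exact DFunLike.congr_fun h' y
  let b : specOver k R' ⟶ B := specMap (θ.restrictScalars k) ≫ i ≫ i₁
  have hm : specMap (IsScalarTower.toAlgHom k S' R') ≫ m = evalMap (b ▷ X ≫ Φ) s := by
    rw [evalMap_whiskerRight]
    simp only [b, m, Category.assoc]
    change _ = specMap _ ≫ i ≫ ev
    rw [← hij, ← Category.assoc, ← Category.assoc, ← Category.assoc, specMap_comp, specMap_comp,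
      specMap_comp]
    congr 2
    ext x
    exact (IsScalarTower.algebraMap_apply S S' R' (φ.rangeRestrict x)).symm.trans
      (θ.commutes (φ.rangeRestrict x)).symm
  obtain ⟨ρ₀, hρ₀, hρ₀_inj, hρ₀G⟩ := exists_injective_family_of_finite_free hinj
    (Φ := b ▷ X ≫ Φ) (ρ := fun a => ρ (a ≫ b))
    (fun a x => by rw [← Category.assoc, lift_whiskerRight, hρ])
    (s := s) (fun Q _ _ p q h u => by
      have := hs Q (p ≫ specMap (θ.restrictScalars k) ≫ i)
        (q ≫ specMap (θ.restrictScalars k) ≫ i)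
      simp only [evalAt_whiskerRight, b, Category.assoc] at h this ⊢
      exact this h u) hm hm_inj
  have hcl : closure (Set.range m.left) = closure (Set.range (evalMap Φ s).left) := by
    have hi' : DenseRange i.left := i.left.isOpenEmbedding.isOpen_range.dense ⟨_, r, rfl⟩
    rw [← closure_range_comp_of_denseRange i₁ _ hi₁, ← closure_range_comp_of_denseRange i _ hi',
      closure_range_comp_of_denseRange (specMap l) _ (denseRange_specMap l hl),
      ← closure_range_comp_of_denseRange (specMap φ.range.val) _
        (denseRange_specMap _ Subtype.val_injective), ← Category.assoc, specMap_comp]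
    exact congrArg (fun e => closure (Set.range e.left)) hij
  rw [← hcl]
  have : IrreducibleSpace (specOver k S').left :=
    inferInstanceAs (IrreducibleSpace (PrimeSpectrum S'))
  have : IsReduced (specOver k S').left := inferInstanceAs (IsReduced (Spec _))
  exact (topologicalKrullDim_closure_range_le m).trans (le_dimSubgroup hρ₀ hρ₀_inj fun c => by
    obtain ⟨a, ha⟩ := hρ₀G c
    exact ha ▸ hG _)

/-! ### Dimension of connected groups -/

/-- In bounding the dimension of a group, only affine parameter varieties need be considered. -/
theorem dimSubgroup_le_of_forall_specOver [IsAlgClosed k] {X : Over (Spec (CommRingCat.of k))}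
    {G : Subgroup (Aut X)} {d : WithBot ℕ∞}
    (h : ∀ (R : Type u) [CommRing R] [IsDomain R] [Algebra k R] [Algebra.FiniteType k R]
      (ρ : Pt (specOver k R) → Aut X), IsMorphismToAut ρ → Function.Injective ρ →
        (∀ a, ρ a ∈ G) → topologicalKrullDim (specOver k R).left ≤ d) : dimSubgroup G ≤ d := by
  refine sSup_le ?_
  rintro _ ⟨A, ρ, _, _, ⟨Φ, hρ⟩, hinj, hG, rfl⟩
  have := IsVariety.locallyOfFiniteType (X := A)
  have := IsVariety.isReduced (X := A)
  refine topologicalKrullDim_le_of_isOpenEmbedding fun a => ?_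
  obtain ⟨R, _, _, j, hj, ⟨r, hr⟩, -⟩ := exists_affine_chart A isOpen_univ (Set.mem_univ a)
  have : Nontrivial R := PrimeSpectrum.nonempty_iff_nontrivial.mp ⟨r⟩
  have := isDomain_of_isOpenImmersion j
  have := finiteType_of_isOpenImmersion j
  have hmono : Mono j := Over.mono_of_mono_left j
  refine ⟨_, inferInstance, j.left, j.left.isOpenEmbedding, ⟨r, hr⟩, h R (fun p => ρ (p ≫ j))
    ⟨j ▷ X ≫ Φ, fun p x => ?_⟩ (fun p q hpq => (cancel_mono j).mp (hinj hpq)) fun p => hG _⟩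
  rw [← Category.assoc, lift_whiskerRight, hρ]

/-- If `dim G` is finite, then it is attained by a family whose parameter variety is affine. -/
theorem exists_specOver_topologicalKrullDim_eq_dimSubgroup [IsAlgClosed k]
    {X : Over (Spec (CommRingCat.of k))} {G : Subgroup (Aut X)} (h : dimSubgroup G ≠ ⊤) :
    ∃ (n : ℕ) (R : Type u) (_ : CommRing R) (_ : IsDomain R) (_ : Algebra k R)
      (_ : Algebra.FiniteType k R) (ρ : Pt (specOver k R) → Aut X), IsMorphismToAut ρ ∧
        Function.Injective ρ ∧ (∀ a, ρ a ∈ G) ∧ dimSubgroup G = n ∧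
        topologicalKrullDim (specOver k R).left = n := by
  have hle : ∀ (R : Type u) [CommRing R] [IsDomain R] [Algebra k R] [Algebra.FiniteType k R]
      (ρ : Pt (specOver k R) → Aut X), IsMorphismToAut ρ → Function.Injective ρ →
        (∀ a, ρ a ∈ G) → topologicalKrullDim (specOver k R).left ≤ dimSubgroup G := by
    intro R _ _ _ _ ρ h₁ h₂ h₃
    have : IrreducibleSpace (specOver k R).left :=
      inferInstanceAs (IrreducibleSpace (PrimeSpectrum R))
    exact le_dimSubgroup h₁ h₂ h₃
  -- the constant family over a point shows that `dim G` is not `⊥`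
  have htriv : ∃ ρ : Pt (specOver k k) → Aut X, IsMorphismToAut ρ ∧ Function.Injective ρ ∧
      ∀ a, ρ a ∈ G := by
    refine ⟨fun _ => 1, ⟨snd _ _, fun a x => ?_⟩, fun a b _ => ?_, fun _ => G.one_mem⟩
    · rw [lift_snd]
      exact (Category.comp_id x).symm
    · obtain ⟨α, rfl⟩ := ptOfAlgHom_surjective a
      obtain ⟨β, rfl⟩ := ptOfAlgHom_surjective b
      exact congrArg _ (Subsingleton.elim α β)
  obtain ⟨ρ₁, h₁, h₁', h₁''⟩ := htriv
  obtain ⟨n₁, hn₁, -⟩ := exists_ringKrullDim_eq_trdeg k k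
  have hle₁ := hle k ρ₁ h₁ h₁' h₁''
  rw [topologicalKrullDim_specOver, hn₁] at hle₁
  obtain ⟨n, hn⟩ : ∃ n : ℕ, dimSubgroup G = n := by
    generalize dimSubgroup G = d at *
    induction d using WithBot.recBotCoe with
    | bot => simp at hle₁
    | coe d =>
      induction d using ENat.recTopCoe with
      | top => exact absurd rfl h
      | coe n => exact ⟨n, rfl⟩
  by_contra hcon
  have hlt : ∀ (R : Type u) [CommRing R] [IsDomain R] [Algebra k R] [Algebra.FiniteType k R]
      (ρ : Pt (specOver k R) → Aut X), IsMorphismToAut ρ → Function.Injective ρ →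
        (∀ a, ρ a ∈ G) → ∃ m : ℕ, m < n ∧ topologicalKrullDim (specOver k R).left = m := by
    intro R _ _ _ _ ρ h₁ h₂ h₃
    obtain ⟨m, hm, -⟩ := exists_ringKrullDim_eq_trdeg k R
    rw [← topologicalKrullDim_specOver (k := k)] at hm
    refine ⟨m, lt_of_le_of_ne ?_ ?_, hm⟩
    · have := hle R ρ h₁ h₂ h₃
      rw [hm, hn] at this
      exact_mod_cast this
    · rintro rfl
      exact hcon ⟨m, R, _, ‹_›, _, ‹_›, ρ, h₁, h₂, h₃, hn, hm⟩
  obtain ⟨m₁, hm₁, -⟩ := hlt k ρ₁ h₁ h₁' h₁''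
  have : dimSubgroup G ≤ (n - 1 : ℕ) := by
    refine dimSubgroup_le_of_forall_specOver fun R _ _ _ _ ρ h₁ h₂ h₃ => ?_
    obtain ⟨m, hm, hm'⟩ := hlt R ρ h₁ h₂ h₃
    rw [hm']
    exact_mod_cast Nat.le_sub_one_of_lt hm
  rw [hn] at this
  have : n ≤ n - 1 := by exact_mod_cast this
  omega

/-- The members of an injective family with affine parameter space are distinguished by their values
at finitely many points of `X`. -/
theorem exists_finset_separating [IsAlgClosed k] {X : Over (Spec (CommRingCat.of k))}
    [IsVariety X] {R : Type u} [CommRing R] [Algebra k R] [Algebra.FiniteType k R]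
    {Φ : specOver k R ⊗ X ⟶ X} {ρ : Pt (specOver k R) → Aut X}
    (hρ : ∀ a x, lift a x ≫ Φ = x ≫ (ρ a).hom) (hinj : Function.Injective ρ) :
    ∃ s : Finset (Pt X), ∀ a b : Pt (specOver k R),
      (∀ u ∈ s, u ≫ (ρ a).hom = u ≫ (ρ b).hom) → a = b := by
  have := IsVariety.isSeparated (X := X)
  have := IsVariety.locallyOfFiniteType (X := X)
  have := IsVariety.isReduced (X := X)
  obtain ⟨s, hs⟩ := exists_finset_forall_specMap_comp_eq fun u => evalAt Φ u
  refine ⟨s, fun a b h => hinj ?_⟩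
  ext1
  refine hom_ext_of_pt fun u => ?_
  obtain ⟨α, rfl⟩ := ptOfAlgHom_surjective a
  obtain ⟨β, rfl⟩ := ptOfAlgHom_surjective b
  simp only [← pt_comp_evalAt Φ hρ, ptOfAlgHom, Category.assoc] at h ⊢
  rw [hs k α β fun u hu => (cancel_epi _).mp (h u hu)]

/-- Let `C` be an injective family in the connected group `G` with `dim C = dim G < ∞`, and let `σ`
be a finite family of points of `X`. Then the closure of the set of the values of `C` at `σ`
contains the values of `g * c` for `g ∈ G` and `c` in `C`. Indeed, let `B` be an irreducible family
in `G` that contains `g` and `1`. The family of all products `b * c` is irreducible, so at a large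
finite set of points its values have a closure of dimension at most `dim G`. This closure contains
the values of `C`, which have the same dimension; so the two closures agree. -/
theorem val_mem_closure_range_evalAt [IsAlgClosed k] {X : Over (Spec (CommRingCat.of k))}
    [IsVariety X] {G : Subgroup (Aut X)} (hG : IsConnectedSubgroup G) {n : ℕ}
    (hn : dimSubgroup G = n) {C : Over (Spec (CommRingCat.of k))} [IsVariety C]
    [IrreducibleSpace C.left] {Φ : C ⊗ X ⟶ X} {ρ : Pt C → Aut X}
    (hρ : ∀ a x, lift a x ≫ Φ = x ≫ (ρ a).hom) (hρG : ∀ c, ρ c ∈ G)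
    (hC : topologicalKrullDim C.left = n) {s₁ : Finset (Pt X)}
    (hs₁ : ∀ a b : Pt C, (∀ u ∈ s₁, u ≫ (ρ a).hom = u ≫ (ρ b).hom) → a = b)
    {ι : Type u} [Finite ι] (σ : ι → Pt X) (c : Pt C) {g : Aut X} (hg : g ∈ G) :
    Pt.val (Limits.Pi.lift fun u => σ u ≫ (ρ c).hom ≫ g.hom) ∈
      closure (Set.range (Limits.Pi.lift fun u => evalAt Φ (σ u)).left) := by
  classical
  have := Fintype.ofFinite ι
  have := IsVariety.isSeparated (X := X)
  have := IsVariety.locallyOfFiniteType (X := X)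
  have := IsVariety.locallyOfFiniteType (X := C)
  have := IsVariety.isReduced (X := C)
  obtain ⟨B, ρB, _, _, ⟨ΦB, hρB⟩, hρBG, ⟨b₁, rfl⟩, ⟨b₀, hb₀⟩⟩ := hG g hg
  have := IsVariety.locallyOfFiniteType (X := B)
  have : LocallyOfFiniteType (B ⊗ C).hom := by
    rw [Over.tensorObj_hom]
    infer_instance
  have := irreducibleSpace_tensorObj (A := B) (B := C)
  let Ψ : (B ⊗ C) ⊗ X ⟶ X := (α_ B C X).hom ≫ B ◁ Φ ≫ ΦB
  let τ : Pt (B ⊗ C) → Aut X := fun p => ρB (p ≫ fst _ _) * ρ (p ≫ snd _ _)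
  have hτ : ∀ p x, lift p x ≫ Ψ = x ≫ (τ p).hom := by
    intro p x
    have : lift p x ≫ Ψ = lift (p ≫ fst _ _) (lift (p ≫ snd _ _) x ≫ Φ) ≫ ΦB := by
      simp only [Ψ, ← Category.assoc]
      congr 1
      apply CartesianMonoidalCategory.hom_ext
      · simp
      · simp only [Category.assoc, whiskerLeft_snd, lift_snd]
        rw [← Category.assoc, ← Category.assoc]
        congr 1
        apply CartesianMonoidalCategory.hom_ext <;> simp
    rw [this, hρ, hρB]
    exact Category.assoc _ _ _
  obtain ⟨s, hs, hdim⟩ := exists_finset_topologicalKrullDim_closure_range_evalMap_le hτ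
    (G := G) (fun p => G.mul_mem (hρBG _) (hρG _)) (s₁ ∪ Finset.univ.image σ)
  -- `C` is the slice of `B × C` over the parameter `b₀` of the identity
  have hsub : closure (Set.range (evalMap Φ s).left) ⊆ closure (Set.range (evalMap Ψ s).left) := by
    refine closure_minimal (range_subset_of_forall_val_mem _ isClosed_closure fun p => ?_)
      isClosed_closure
    have : p ≫ evalMap Φ s = lift b₀ p ≫ evalMap Ψ s := by
      refine Limits.Pi.hom_ext _ _ fun u => ?_
      rw [Category.assoc, Category.assoc, evalMap_π, evalMap_π, pt_comp_evalAt _ hρ,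
        pt_comp_evalAt _ hτ]
      simp only [τ, lift_fst, lift_snd, hb₀, one_mul]
    rw [this]
    exact subset_closure ⟨_, rfl⟩
  have heq : closure (Set.range (evalMap Φ s).left) = closure (Set.range (evalMap Ψ s).left) := by
    refine IsIrreducible.eq_of_topologicalKrullDim_le ?_ isClosed_closure hsub n (hn ▸ hdim)
      (hC ▸ topologicalKrullDim_le_closure_range _ fun p q hpq => hs₁ _ _ fun u hu => ?_)
    · rw [← Set.image_univ]
      exact ((IrreducibleSpace.isIrreducible_univ _).image _
        (evalMap Ψ s).left.continuous.continuousOn).closure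
    · have := hpq =≫ Limits.Pi.π _ (⟨u, hs (Finset.mem_union_left _ hu)⟩ : s)
      rwa [Category.assoc, Category.assoc, evalMap_π, pt_comp_evalAt _ hρ,
        pt_comp_evalAt _ hρ] at this
  have hmem (u : ι) : σ u ∈ s :=
    hs (Finset.mem_union_right _ (Finset.mem_image_of_mem _ (Finset.mem_univ u)))
  -- project from the large power of `X` to the power indexed by `ι`
  let q : (∏ᶜ fun _ : s => X) ⟶ ∏ᶜ fun _ : ι => X :=
    Limits.Pi.lift fun u => Limits.Pi.π _ ⟨σ u, hmem u⟩
  have hq₁ : (lift b₁ c ≫ evalMap Ψ s) ≫ q =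
      Limits.Pi.lift fun u => σ u ≫ (ρ c).hom ≫ (ρB b₁).hom := by
    refine Limits.Pi.hom_ext _ _ fun u => ?_
    rw [Category.assoc, Limits.Pi.lift_π, Limits.Pi.lift_π, Category.assoc, evalMap_π,
      pt_comp_evalAt _ hτ]
    simp only [τ, lift_fst, lift_snd]
    rfl
  have hq₂ : evalMap Φ s ≫ q = Limits.Pi.lift fun u => evalAt Φ (σ u) := by
    refine Limits.Pi.hom_ext _ _ fun u => ?_
    rw [Category.assoc, Limits.Pi.lift_π, Limits.Pi.lift_π, evalMap_π]
  have hv : Pt.val (lift b₁ c ≫ evalMap Ψ s) ∈ closure (Set.range (evalMap Φ s).left) :=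
    heq ▸ subset_closure ⟨_, rfl⟩
  rw [← hq₁, ← hq₂, Pt.val_comp]
  have := image_closure_subset_closure_image q.left.continuous ⟨_, hv, rfl⟩
  rwa [← Set.range_comp] at this

end VarietyAut

theorem mainTheorem7 {k : Type u} [Field k] [IsAlgClosed k]
    (X : Over (Spec (CommRingCat.of k))) [VarietyAut.IsVariety X]
    (G : Subgroup (Aut X)) (hG : VarietyAut.IsConnectedSubgroup G)
    (X' : Over (Spec (CommRingCat.of k))) [VarietyAut.IsVariety X']
    (i : X' ⟶ X) [IsImmersion i.left] (hi : VarietyAut.IsInvariant G i) :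
    VarietyAut.dimSubgroup (VarietyAut.restrictHom G i hi).range ≤ VarietyAut.dimSubgroup G := by
  open VarietyAut in
  have := IsVariety.isSeparated (X := X)
  have := IsVariety.locallyOfFiniteType (X := X)
  by_cases htop : dimSubgroup G = ⊤
  · rw [htop]
    exact le_top
  obtain ⟨n, RC, _, _, _, _, ρC, ⟨ΦC, hρC⟩, hinjC, hρCG, hn, hC⟩ :=
    exists_specOver_topologicalKrullDim_eq_dimSubgroup htop
  have : IrreducibleSpace (specOver k RC).left :=
    inferInstanceAs (IrreducibleSpace (PrimeSpectrum RC))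
  have : IsReduced (specOver k RC).left := inferInstanceAs (IsReduced (Spec _))
  obtain ⟨s₁, hs₁⟩ := exists_finset_separating hρC hinjC
  obtain ⟨γ⟩ := exists_algHom_of_nontrivial k RC
  let c := ptOfAlgHom γ
  refine dimSubgroup_le_of_forall_specOver fun R _ _ _ _ ρ ⟨Φ, hρ⟩ hinj hρG => ?_
  have : IrreducibleSpace (specOver k R).left :=
    inferInstanceAs (IrreducibleSpace (PrimeSpectrum R))
  have : IsReduced (specOver k R).left := inferInstanceAs (IsReduced (Spec _))
  have hmono : Mono i := mono_of_isImmersion i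
  obtain ⟨s', hs'⟩ := exists_finset_separating hρ hinj
  -- the points are shifted so that `ρC c` maps `σ u` to the point `u` of `X'`
  let σ : s' → Pt X := fun u => u.1 ≫ i ≫ (ρC c).inv
  let e : specOver k RC ⟶ ∏ᶜ fun _ : s' => X := Limits.Pi.lift fun u => evalAt ΦC (σ u)
  let h : specOver k R ⟶ ∏ᶜ fun _ : s' => X := Limits.Pi.lift fun u => evalAt Φ u.1 ≫ i
  have hh (a : Pt (specOver k R)) (u : s') :
      (a ≫ h) ≫ Limits.Pi.π _ u = u.1 ≫ (ρ a).hom ≫ i := by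
    rw [Category.assoc, Limits.Pi.lift_π, ← Category.assoc, pt_comp_evalAt Φ hρ, Category.assoc]
  -- the values of the family `ρ` are values of `g * ρC c` with `g ∈ G` restricting to `ρ a`
  have hsub : closure (Set.range h.left) ⊆ closure (Set.range e.left) := by
    refine closure_minimal (range_subset_of_forall_val_mem _ isClosed_closure fun a => ?_)
      isClosed_closure
    obtain ⟨g, hg⟩ := hρG a
    have hgi : (ρ a).hom ≫ i = i ≫ g.1.hom := hg ▸ restrict_comp G i hi g
    have key : a ≫ h = Limits.Pi.lift fun u => σ u ≫ (ρC c).hom ≫ g.1.hom := by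
      refine Limits.Pi.hom_ext _ _ fun u => ?_
      rw [hh, hgi, Limits.Pi.lift_π]
      simp only [σ, Category.assoc]
      exact congrArg (fun f => u.1 ≫ i ≫ f) (Iso.inv_hom_id_assoc (ρC c) _).symm
    rw [key]
    exact val_mem_closure_range_evalAt hG hn hρC hρCG hC hs₁ σ c g.2
  calc topologicalKrullDim (specOver k R).left
      ≤ topologicalKrullDim (closure (Set.range h.left)) := by
        refine topologicalKrullDim_le_closure_range h fun a b hab => hs' a b fun u hu => ?_
        have := hab =≫ Limits.Pi.π _ (⟨u, hu⟩ : s')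
        rwa [hh, hh, ← Category.assoc, ← Category.assoc, cancel_mono] at this
    _ ≤ topologicalKrullDim (closure (Set.range e.left)) :=
        (Topology.IsEmbedding.inclusion hsub).isInducing.topologicalKrullDim_le
    _ ≤ topologicalKrullDim (specOver k RC).left := topologicalKrullDim_closure_range_le e
    _ = dimSubgroup G := hC.trans hn.symm
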